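/- Throughout, $q=e^{2\pi i\tau}$, $\mathbf{e}(z)=e^{2\pi i z}$, $\eta(\tau)=q^{1/24}\prod_{m\ge1}(1-q^m)$, and $(\tfrac{\cdot}{\cdot})$ is the Kronecker–Jacobi symbol. Let $r_n\in\mathbb Z$ ($n\mid N$) and let $f(\tau)=\prod_{n\mid N}\eta(n\tau)^{r_n}$ be an eta-quotient of level $N$, i.e. $N=\operatorname{lcm}\{n: r_n\ne0\}$ (with $N=1$ if all $r_n=0$), of weight $k=\frac12\sum_{n\mid N}r_n$, and let $\chi$ be its character (multiplier system) on the double cover of $\Gamma_0(N)$. Assume that $f$ is weakly admissible: $f$ is holomorphic at all cusps, so $f\in M_k(\Gamma_0(N),\chi)$, and either (I) $\dim_{\mathbb C}M_k(\Gamma_0(N),\chi)=1$, or (II) $\dim_{\mathbb C}M_k(\Gamma_0(N),\chi)\ge2$, $\dim_{\mathbb C}S_k(\Gamma_0(N),\chi)=1$ and $f$ is a cusp form. Assume moreover that $x_N:=\sum_{n\mid N}n r_n=0$. Put $$m_f=\frac{24}{\gcd\bigl(24,\sum_{n\mid N}\frac Nn r_n,\sum_{n\mid N}n r_n\bigr)},\qquad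 \varPi=\prod_{n\mid N}(N/n)^{|r_n|},$$ let $\delta=0$ if $\varPi=2^\alpha(4m+1)$ and $\delta=1$ if $\varPi=2^\alpha(4m+3)$ with integers $\alpha,m\ge0$, and let $L_f$ be the set of integers $l\ge1$ with $l\equiv1\pmod{m_f}$ which, in case $k\notin\mathbb Z$, are also perfect squares. Then $f$ has an expansion $f(\tau)=\sum_{n\ge0}c_f(n)q^n$, convergent for all $\tau$ in the upper half plane, and the following holds. Let $l\in L_f$ be such that $p^2\nmid l$ for every prime $p\nmid N$, and such that at least one of $l$ and $N$ is odd. Then $$c_f(l)=\begin{cases}-r_1\displaystyle\sum_{a\mid l,\ (a,N)=1}\Bigl(\frac a{\varPi}\Bigr)a^{k-1}&\text{if }2\mid l,\ 2\nmid N,\\[2ex]-r_1\displaystyle\sum_{a\mid l,\ (a,N)=1}\Bigl(\frac a{\varPi}\Bigr)a^{k-1}\,\mathbf e\Bigl(\frac{(k+\delta)(l-l/a)}4\Bigr)&\text{if }2\nmid l.\end{cases}$$ In particular, if $\operatorname{rad}(l)\mid\operatorname{rad}(N)$, where $\operatorname{rad}(n)$ is the product of the primes dividing $n$, then $c_f(l)=-r_1$.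 -/

import Mathlib

open scoped MatrixGroups

noncomputable section

namespace EtaQuotient

/-- The Kronecker-Jacobi symbol `(m/n)` of two integers. For `n ≠ 0` it is the product of the
sign symbol (`-1` exactly when `m, n < 0`), of `(m/2) ^ v₂(n)`, where `(m/2)` is `0` for even `m`
and `(-1) ^ ((m ^ 2 - 1) / 8)` for odd `m`, and of the Jacobi symbol of `m` over the odd part
of `|n|`. -/
def kronecker (m n : ℤ) : ℤ :=
  if n = 0 then (if m = 1 ∨ m = -1 then 1 else 0)
  else (if n < 0 ∧ m < 0 then -1 else 1) * ZMod.χ₈ (m : ZMod 8) ^ n.natAbs.factorization 2 *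
    jacobiSym m (n.natAbs / 2 ^ n.natAbs.factorization 2)

/-- The sawtooth function `((x))`: `x - ⌊x⌋ - 1/2` for non-integral `x`, and `0` for integral `x`. -/
def sawtooth (x : ℚ) : ℚ := if Int.fract x = 0 then 0 else Int.fract x - 1 / 2

/-- The Dedekind sum `s(h, k) = ∑_{j mod k} ((j / k)) ((h j / k))`, for `k ≥ 1`. -/
def dedekindSum (h k : ℤ) : ℚ :=
  ∑ j ∈ Finset.range k.toNat, sawtooth ((j : ℚ) / k) * sawtooth ((h * j : ℚ) / k)

/-- The function `Ψ` on matrices `(a, b; c, d)` in `SL(2, ℤ)` for which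
`exp (2 π i Ψ / 24)` is the multiplier of the Dedekind eta function. -/
def Psi (a b c d : ℤ) : ℚ :=
  if 0 < c then ((a + d : ℤ) : ℚ) / c + 12 * dedekindSum (-d) c - 3
  else if c < 0 then ((a + d : ℤ) : ℚ) / c + 12 * dedekindSum d (-c) + 3
  else if 0 < a then b
  else -b - 6

/-- `2 k = ∑_{n ∣ N} r_n`, twice the weight `k` of the eta-quotient with exponents `r_n`. -/
def twoK (N : ℕ) (r : ℕ → ℤ) : ℤ := ∑ n ∈ N.divisors, r n

/-- The eta-quotient `f(τ) = ∏_{n ∣ N} η(n τ) ^ r_n` on the upper half plane. Only the values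
`r n` with `n ∣ N` matter. -/
def etaQuotient (N : ℕ) (r : ℕ → ℤ) (τ : UpperHalfPlane) : ℂ :=
  ∏ n ∈ N.divisors, ModularForm.eta ((n : ℂ) * (τ : ℂ)) ^ r n

/-- The slash operator of weight `w / 2` for the element `(γ, ε)` of the double cover of `SL(2, ℤ)`:
`(ε √(c τ + d)) ^ (-w) * f (γ τ)`, with the principal branch of the square root. Elements of the
double cover are written as a matrix `γ` together with a sign `ε`. -/
def slash (w : ℤ) (γ : SL(2, ℤ)) (ε : ℤˣ) (f : UpperHalfPlane → ℂ) (τ : UpperHalfPlane) : ℂ :=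
  ((((ε : ℤ) : ℂ)) * ((γ 1 0 : ℂ) * (τ : ℂ) + (γ 1 1 : ℂ)) ^ (1 / 2 : ℂ)) ^ (-w) * f (γ • τ)

/-- The character of the eta-quotient `∏_{n ∣ N} η(n τ) ^ r_n` on the double cover of `Γ₀(N)`:
`(γ, ε) ↦ ε ^ (-2k) exp (2 π i / 24 * ∑_{n ∣ N} r_n Ψ(a, b n; c / n, d))`. It is only used at
`γ ∈ Γ₀(N)`, where every `c / n` is an integer. -/
def etaChar (N : ℕ) (r : ℕ → ℤ) (γ : SL(2, ℤ)) (ε : ℤˣ) : ℂ :=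
  ((ε : ℤ) : ℂ) ^ (-twoK N r) *
    Complex.exp (2 * Real.pi * Complex.I *
      (((1 / 24 : ℚ) * ∑ n ∈ N.divisors,
        (r n : ℚ) * Psi (γ 0 0) (γ 0 1 * n) (γ 1 0 / n) (γ 1 1) : ℚ) : ℂ))

/-- The slash operator is `ℂ`-linear in the function. -/
theorem slash_add (w : ℤ) (γ : SL(2, ℤ)) (ε : ℤˣ) (f g : UpperHalfPlane → ℂ) :
    slash w γ ε (f + g) = slash w γ ε f + slash w γ ε g := by
  funext τ
  simp only [slash, Pi.add_apply]
  ring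

theorem slash_smul (w : ℤ) (γ : SL(2, ℤ)) (ε : ℤˣ) (c : ℂ) (f : UpperHalfPlane → ℂ) :
    slash w γ ε (c • f) = c • slash w γ ε f := by
  funext τ
  simp only [slash, Pi.smul_apply, smul_eq_mul]
  ring

theorem slash_zero (w : ℤ) (γ : SL(2, ℤ)) (ε : ℤˣ) :
    slash w γ ε (0 : UpperHalfPlane → ℂ) = 0 := by
  funext τ
  simp [slash]

/-- The space `M_{w/2}(Γ₀(N), χ)` of modular forms: holomorphic functions on the upper half plane
with `f|(γ, ε) = χ(γ, ε) f` for `γ ∈ Γ₀(N)`, such that every `f|(γ, ε)` with `γ ∈ SL(2, ℤ)` is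
bounded at `i∞` (its expansion in fractional powers of `q` has no negative exponents). -/
def modForms (N : ℕ) (w : ℤ) (χ : SL(2, ℤ) → ℤˣ → ℂ) : Submodule ℂ (UpperHalfPlane → ℂ) where
  carrier := {f | MDifferentiable (modelWithCornersSelf ℂ ℂ) (modelWithCornersSelf ℂ ℂ) f ∧
    (∀ γ ∈ CongruenceSubgroup.Gamma0 N, ∀ ε : ℤˣ, slash w γ ε f = χ γ ε • f) ∧
    ∀ (γ : SL(2, ℤ)) (ε : ℤˣ), UpperHalfPlane.IsBoundedAtImInfty (slash w γ ε f)}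
  add_mem' := by
    rintro f g ⟨hf1, hf2, hf3⟩ ⟨hg1, hg2, hg3⟩
    refine ⟨hf1.add hg1, fun γ hγ ε => ?_, fun γ ε => ?_⟩
    · rw [slash_add, hf2 γ hγ ε, hg2 γ hγ ε, smul_add]
    · rw [slash_add]
      exact Filter.BoundedAtFilter.add (hf3 γ ε) (hg3 γ ε)
  zero_mem' := by
    refine ⟨mdifferentiable_const, fun γ _ ε => ?_, fun γ ε => ?_⟩
    · rw [slash_zero, smul_zero]
    · rw [slash_zero]
      exact Filter.const_boundedAtFilter _ (0 : ℂ)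
  smul_mem' := by
    rintro c f ⟨hf1, hf2, hf3⟩
    refine ⟨hf1.const_smul c, fun γ hγ ε => ?_, fun γ ε => ?_⟩
    · rw [slash_smul, hf2 γ hγ ε, smul_comm]
    · rw [slash_smul]
      exact Filter.BoundedAtFilter.smul c (hf3 γ ε)

/-- The space `S_{w/2}(Γ₀(N), χ)` of cusp forms: the modular forms `f` for which every `f|(γ, ε)`
with `γ ∈ SL(2, ℤ)` tends to zero at `i∞`. -/
def cuspForms (N : ℕ) (w : ℤ) (χ : SL(2, ℤ) → ℤˣ → ℂ) : Submodule ℂ (UpperHalfPlane → ℂ) where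
  carrier := {f | f ∈ modForms N w χ ∧
    ∀ (γ : SL(2, ℤ)) (ε : ℤˣ), UpperHalfPlane.IsZeroAtImInfty (slash w γ ε f)}
  add_mem' := by
    rintro f g ⟨hf1, hf2⟩ ⟨hg1, hg2⟩
    refine ⟨(modForms N w χ).add_mem hf1 hg1, fun γ ε => ?_⟩
    rw [slash_add]
    exact Filter.ZeroAtFilter.add (hf2 γ ε) (hg2 γ ε)
  zero_mem' := by
    refine ⟨(modForms N w χ).zero_mem, fun γ ε => ?_⟩
    rw [slash_zero]
    exact Filter.zero_zeroAtFilter _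
  smul_mem' := by
    rintro c f ⟨hf1, hf2⟩
    refine ⟨(modForms N w χ).smul_mem c hf1, fun γ ε => ?_⟩
    rw [slash_smul]
    exact Filter.ZeroAtFilter.smul c (hf2 γ ε)

/-- `∏_{n ∣ N} η(n τ) ^ r_n` is a weakly admissible eta-quotient of level `N`: the level `N` is the
least common multiple of the `n` with `r_n ≠ 0` (and `1` if there are none), the quotient is
holomorphic at all cusps, and, with `χ` its character, either `dim M_k(Γ₀(N), χ) = 1`, or
`dim M_k(Γ₀(N), χ) ≥ 2`, `dim S_k(Γ₀(N), χ) = 1` and it is a cusp form. -/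
structure IsWeaklyAdmissible (N : ℕ) (r : ℕ → ℤ) : Prop where
  level_eq : (N.divisors.filter fun n => r n ≠ 0).lcm id = N
  mem_modForms : etaQuotient N r ∈ modForms N (twoK N r) (etaChar N r)
  dim_eq : Module.rank ℂ (modForms N (twoK N r) (etaChar N r)) = 1 ∨
    (2 ≤ Module.rank ℂ (modForms N (twoK N r) (etaChar N r)) ∧
      Module.rank ℂ (cuspForms N (twoK N r) (etaChar N r)) = 1 ∧
      etaQuotient N r ∈ cuspForms N (twoK N r) (etaChar N r))

/-- `x_N = ∑_{n ∣ N} n r_n`. -/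
def xInf (N : ℕ) (r : ℕ → ℤ) : ℤ := ∑ n ∈ N.divisors, (n : ℤ) * r n

/-- `∑_{n ∣ N} (N / n) r_n`. -/
def xZero (N : ℕ) (r : ℕ → ℤ) : ℤ := ∑ n ∈ N.divisors, ((N / n : ℕ) : ℤ) * r n

/-- `m_f = 24 / gcd (24, ∑ (N / n) r_n, ∑ n r_n)`. -/
def mf (N : ℕ) (r : ℕ → ℤ) : ℕ := 24 / Nat.gcd 24 (Int.gcd (xZero N r) (xInf N r))

/-- The set `L_f`: the positive integers `l ≡ 1 mod m_f` which, if the weight is not an integer,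
are moreover perfect squares. -/
def Lf (N : ℕ) (r : ℕ → ℤ) : Set ℕ :=
  {l | 1 ≤ l ∧ l ≡ 1 [MOD mf N r] ∧ (Odd (twoK N r) → IsSquare l)}

/-- `Π = ∏_{n ∣ N} (N / n) ^ |r_n|`. -/
def bigPi (N : ℕ) (r : ℕ → ℤ) : ℕ := ∏ n ∈ N.divisors, (N / n) ^ (r n).natAbs

/-- `δ = 1` if the odd part of `Π` is `3` modulo `4`, and `δ = 0` if it is `1` modulo `4`. -/
def delta (N : ℕ) (r : ℕ → ℤ) : ℕ :=
  if (bigPi N r / 2 ^ (bigPi N r).factorization 2) % 4 = 3 then 1 else 0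

/-- The coefficient `c_f(n)` of `q ^ n`, `q = exp (2 π i τ)`, in the `q`-expansion of the
eta-quotient `f`. -/
def coeff (N : ℕ) (r : ℕ → ℤ) (n : ℕ) : ℂ :=
  (UpperHalfPlane.qExpansion 1 (etaQuotient N r)).coeff n

end EtaQuotient

end

/-! Since `xInf` vanishes, f has order 0 at the cusp ∞: c_f(0) = 1 and c_f(1) = -r_1. So f is not a
cusp form, alternative (II) is impossible, and M_k(Γ₀(N), χ) is the line spanned by f.

Write l = l₁ l₂ with l₁ dividing a power of N and l₂ prime to N. On matrices (a, b; N c, d) with c,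
d > 0 the multiplier of f is a theta part times ψ(d) e(-d c x₀ / 24), where x₀ = `xZero` and ψ =
`nebentypus`. The operators T_p for p ∣ l₂ and U_{l₁} only replace x₀ by l x₀, and l ≡ 1 mod m_f
means that l x₀ ≡ x₀ mod 24. The image of f therefore lies in the same line and is a multiple of f.
Its q⁰-coefficient is ∑_{a ∣ l₂} ψ(a) a^(k-1) and its q¹-coefficient is c_f(l); comparison with f
gives c_f(l) = -r_1 ∑ ψ(a) a^(k-1). Quadratic reciprocity rewrites ψ(a) through the Kronecker
symbol. In half-integral weight l is a square not divisible by p² for p ∤ N, so l₂ = 1 and U_l alone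
suffices.

The Dedekind sums in `etaChar` are never evaluated. The multiplier comes from the Jacobi-symbol
formula `etaTransf` for odd d > 0, and `IsForm.cross_ratio` shows that a form sharing the multiplier
of f for c, d > 0 behaves like f under all of Γ₀(N), hence has the character χ because f has it. The
other main lemmas are `IsForm.average`, `IsForm.hecke_isForm`, `mult_transf`, `IsForm.coeff_eq` and
`coeff_eq_sum_nebentypus`. -/

noncomputable section

namespace EtaQuotient

/-! ### Twenty-fourth roots of unity -/

/-- The root of unity `exp (2 π i n / 24)`. -/
def e24 (n : ℤ) : ℂ := Complex.exp (2 * Real.pi * Complex.I * n / 24)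

theorem e24_add (m n : ℤ) : e24 (m + n) = e24 m * e24 n := by
  rw [e24, e24, e24, ← Complex.exp_add]
  push_cast
  ring_nf

theorem e24_zero : e24 0 = 1 := by simp [e24]

theorem e24_ne_zero (n : ℤ) : e24 n ≠ 0 := Complex.exp_ne_zero _

theorem e24_neg (n : ℤ) : e24 (-n) = (e24 n)⁻¹ := by
  rw [e24, e24, ← Complex.exp_neg]
  push_cast
  ring_nf

theorem e24_zpow (m n : ℤ) : e24 m ^ n = e24 (m * n) := by
  rw [e24, e24, ← Complex.exp_int_mul]
  push_cast
  ring_nf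

theorem e24_eq_one {n : ℤ} (h : (24 : ℤ) ∣ n) : e24 n = 1 := by
  obtain ⟨k, rfl⟩ := h
  rw [e24, Complex.exp_eq_one_iff]
  exact ⟨k, by push_cast; ring⟩

theorem e24_congr {m n : ℤ} (h : (24 : ℤ) ∣ m - n) : e24 m = e24 n := by
  have : m = (m - n) + n := by ring
  rw [this, e24_add, e24_eq_one h, one_mul]

theorem e24_twelve : e24 12 = -1 := by
  rw [e24, ← Complex.exp_pi_mul_I]
  push_cast
  ring_nf

theorem e24_six : e24 6 = Complex.I := by
  have : (2 * Real.pi * Complex.I * (6 : ℤ) / 24 : ℂ) = Real.pi / 2 * Complex.I := by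
    push_cast; ring
  rw [e24, this, Complex.exp_pi_div_two_mul_I]

theorem e24_twelve_mul (n : ℤ) : e24 (12 * n) = (-1) ^ n := by
  rw [← e24_twelve, e24_zpow]

theorem e24_prod {ι : Type*} (s : Finset ι) (g : ι → ℤ) :
    ∏ i ∈ s, e24 (g i) = e24 (∑ i ∈ s, g i) := by
  classical
  induction s using Finset.induction_on with
  | empty => simp [e24_zero]
  | insert i s hi ih => rw [Finset.prod_insert hi, Finset.sum_insert hi, e24_add, ih]

/-! ### Branches of the square root -/

/-- The principal roots multiply as soon as the arguments of x and y add up inside (-π, π]. This is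
automatic for x in the lower half plane. Otherwise the sum lies in (0, 2π), and positivity of the
imaginary part of x y, i.e. of the sine of the sum, keeps it below π. -/
theorem cpow_half_mul {x y : ℂ} (hx : x ≠ 0) (hy : 0 < y.im)
    (h : x.im < 0 ∨ 0 ≤ x.im ∧ 0 < (x * y).im) :
    (x * y) ^ (1 / 2 : ℂ) = x ^ (1 / 2 : ℂ) * y ^ (1 / 2 : ℂ) := by
  have hy0 : y ≠ 0 := by rintro rfl; simp at hy
  have hya : 0 < y.arg := by
    have h1 : 0 ≤ y.arg := Complex.arg_nonneg_iff.2 hy.le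
    rcases h1.eq_or_lt with h1 | h1
    · rw [eq_comm, Complex.arg_eq_zero_iff] at h1
      linarith [h1.2]
    · exact h1
  have hyb : y.arg < Real.pi := by
    refine lt_of_le_of_ne (Complex.arg_le_pi y) fun h1 => ?_
    rw [Complex.arg_eq_pi_iff] at h1
    linarith [h1.2]
  have key : x.arg + y.arg ∈ Set.Ioc (-Real.pi) Real.pi := by
    rcases h with h | ⟨h, h'⟩
    · have := Complex.arg_neg_iff.2 h
      have := Complex.neg_pi_lt_arg x
      constructor <;> linarith
    · have h1 := Complex.arg_nonneg_iff.2 h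
      refine ⟨by linarith [Real.pi_pos], ?_⟩
      by_contra! h2
      have h3 : (x * y).im = ‖x‖ * ‖y‖ * Real.sin (x.arg + y.arg) := by
        rw [Real.sin_add, Complex.mul_im, ← Complex.norm_mul_cos_arg x,
          ← Complex.norm_mul_sin_arg x, ← Complex.norm_mul_cos_arg y,
          ← Complex.norm_mul_sin_arg y]
        ring
      have h4 : Real.sin (x.arg + y.arg) < 0 := by
        rw [← Real.sin_sub_two_pi]
        apply Real.sin_neg_of_neg_of_neg_pi_lt
        · linarith [Complex.arg_le_pi x]
        · linarith
      have : 0 < ‖x‖ * ‖y‖ := by positivity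
      nlinarith
  rw [Complex.cpow_def_of_ne_zero hx, Complex.cpow_def_of_ne_zero hy0,
    Complex.cpow_def_of_ne_zero (mul_ne_zero hx hy0), Complex.log_mul hx hy0 key, add_mul,
    Complex.exp_add]

theorem neg_cpow_half {x : ℂ} (hx : x.im < 0) :
    (-x) ^ (1 / 2 : ℂ) = Complex.I * x ^ (1 / 2 : ℂ) := by
  have hx0 : x ≠ 0 := by rintro rfl; simp at hx
  rw [Complex.cpow_def_of_ne_zero hx0, Complex.cpow_def_of_ne_zero (neg_ne_zero.2 hx0)]
  have : Complex.log (-x) = Complex.log x + Real.pi * Complex.I := by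
    rw [Complex.log, Complex.log, norm_neg, Complex.arg_neg_eq_arg_add_pi_of_im_neg hx]
    push_cast; ring
  rw [this, add_mul, Complex.exp_add, mul_comm, show Real.pi * Complex.I * (1 / 2 : ℂ) =
    Real.pi / 2 * Complex.I by ring, Complex.exp_pi_div_two_mul_I]

/-! ### Real Möbius transformations of the upper half plane -/

theorem den_ne_zero {c d : ℝ} (h : ¬ (c = 0 ∧ d = 0)) {z : ℂ} (hz : 0 < z.im) :
    (c : ℂ) * z + d ≠ 0 := by
  intro h0
  have h1 := congrArg Complex.im h0
  have h2 := congrArg Complex.re h0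
  simp at h1 h2
  rcases h1 with h1 | h1
  · exact h ⟨h1, by simpa [h1] using h2⟩
  · exact hz.ne' h1

theorem int_den_ne_zero {a b c d : ℤ} (h : a * d - b * c ≠ 0) {z : ℂ} (hz : 0 < z.im) :
    (c : ℂ) * z + d ≠ 0 := by
  have := den_ne_zero (c := c) (d := d) (fun ⟨h1, h2⟩ => h (by
    rw [Int.cast_eq_zero] at h1 h2; simp [h1, h2])) hz
  exact_mod_cast this

theorem im_moebius (a b c d : ℤ) (z : ℂ) :
    (((a : ℂ) * z + b) / (c * z + d)).im = (a * d - b * c : ℤ) * z.im /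
      Complex.normSq (c * z + d) := by
  rw [Complex.div_im]
  simp
  ring

theorem im_moebius_pos {a b c d : ℤ} (h : 0 < a * d - b * c) {z : ℂ} (hz : 0 < z.im) :
    0 < (((a : ℂ) * z + b) / (c * z + d)).im := by
  rw [im_moebius]
  have h1 : (0 : ℝ) < (a * d - b * c : ℤ) := by exact_mod_cast h
  have h2 := Complex.normSq_pos.2 (int_den_ne_zero h.ne' hz)
  positivity

/-! ### The multiplier system of the Dedekind eta function -/

open ModularForm

theorem eta_add_one (z : ℂ) : eta (z + 1) = e24 1 * eta z := by
  have h1 : Function.Periodic.qParam 1 (z + 1) = Function.Periodic.qParam 1 z := by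
    simp [Function.Periodic.qParam, mul_add, Complex.exp_add]
  have h24 : Function.Periodic.qParam 24 (z + 1) = e24 1 * Function.Periodic.qParam 24 z := by
    rw [Function.Periodic.qParam, Function.Periodic.qParam, e24, ← Complex.exp_add]
    push_cast; ring_nf
  simp only [eta, eta_q, h1, h24, mul_assoc]

theorem eta_add_int (z : ℂ) (n : ℤ) : eta (z + n) = e24 n * eta z := by
  induction n using Int.induction_on with
  | zero => simp [e24_zero]
  | succ n ih =>
    push_cast at ih ⊢
    rw [← add_assoc, eta_add_one, ih, ← mul_assoc, ← e24_add, add_comm]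
  | pred n ih =>
    have := eta_add_one (z + ((-n - 1 : ℤ) : ℂ))
    rw [show z + ((-n - 1 : ℤ) : ℂ) + 1 = z + ((-n : ℤ) : ℂ) by push_cast; ring, ih] at this
    have h2 : e24 (-n) = e24 1 * e24 (-n - 1) := by rw [← e24_add]; congr 1; ring
    rw [h2, mul_assoc] at this
    exact (mul_left_cancel₀ (e24_ne_zero 1) this).symm

theorem eta_neg_one_div {z : ℂ} (hz : 0 < z.im) :
    eta (-1 / z) = e24 (-3) * (z ^ (1 / 2 : ℂ) * eta z) := by
  have h := eta_comp_eq_csqrt_I_inv (show z ∈ UpperHalfPlane.upperHalfPlaneSet from hz)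
  have hI : (Complex.sqrt Complex.I)⁻¹ = e24 (-3) := by
    rw [e24_neg, Complex.sqrt, Complex.cpow_def_of_ne_zero Complex.I_ne_zero, Complex.log_I, e24]
    congr 2
    push_cast; ring
  have h2 : (eta (-1 / z)) = (Complex.sqrt Complex.I)⁻¹ * (Complex.sqrt z * eta z) := h
  rw [h2, hI]
  congr 3
  simp [Complex.sqrt]

/-- The exponent of the eta multiplier for odd `d > 0`. -/
def etaExp (a b c d : ℤ) : ℤ := (a + d) * c - b * d * (c ^ 2 - 1) + 3 * d - 3 - 3 * c * d

/-- The transformation formula of `η` under the matrix `(a, b; c, d)`. -/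
def EtaTransf (a b c : ℤ) (d : ℕ) : Prop := ∀ z : ℂ, 0 < z.im →
  eta ((a * z + b) / (c * z + d)) =
    jacobiSym c d * e24 (etaExp a b c d) * (c * z + d) ^ (1 / 2 : ℂ) * eta z

/-- Right multiplication by (1, 0; 1, 1), that is, substitution of z / (z + 1) for z. It leaves d
and the Jacobi symbol unchanged; with both implications available, c can be moved freely within its
class modulo d. -/
theorem etaTransf_iff_add (a b c : ℤ) (d : ℕ) (hd : 0 < d) (hodd : Odd d)
    (hdet : a * d - b * c = 1) : EtaTransf a b c d ↔ EtaTransf (a + b) b (c + d) d := by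
  have hjac : jacobiSym (c + d) d = jacobiSym c d := jacobiSym.mod_left' (by simp)
  have hexp : e24 (etaExp a b c d) = e24 1 * e24 (etaExp (a + b) b (c + d) d) := by
    rw [← e24_add]
    apply e24_congr
    -- The exponents differ by a multiple of 1 - d²: oddness of d supplies the factor 8, and a check
    -- of all residues with determinant one supplies the factor 3.
    have h8 : (8 : ℤ) ∣ 1 - (d : ℤ) ^ 2 := by
      obtain ⟨k, hk⟩ := Int.eight_dvd_sq_sub_one_of_odd (k := d) (by exact_mod_cast hodd)
      exact ⟨-k, by linear_combination -hk⟩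
    have h3 : (3 : ℤ) ∣ (1 - (d : ℤ) ^ 2) * (2 + 2 * b * c + b * d) := by
      have h0 : ∀ a b c d : ZMod 3, a * d - b * c = 1 →
          (1 - d ^ 2) * (2 + 2 * b * c + b * d) = 0 := by decide
      have h1 := h0 a b c d (by exact_mod_cast congrArg (Int.cast : ℤ → ZMod 3) hdet)
      exact (ZMod.intCast_zmod_eq_zero_iff_dvd _ 3).1 (by push_cast; exact h1)
    have h24 : (24 : ℤ) ∣ (1 - (d : ℤ) ^ 2) * (2 + 2 * b * c + b * d) := by
      have := IsCoprime.mul_dvd (by norm_num : IsCoprime (8 : ℤ) 3)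
        (h8.mul_right (2 + 2 * b * c + b * d)) h3
      norm_num at this
      exact this
    obtain ⟨k, hk⟩ := h24
    exact ⟨-k, by simp only [etaExp]; linear_combination -hk - hdet⟩
  have key : ∀ z : ℂ, 0 < z.im →
      (eta ((a * (z / (z + 1)) + b) / (c * (z / (z + 1)) + d)) =
        jacobiSym c d * e24 (etaExp a b c d) * (c * (z / (z + 1)) + d) ^ (1 / 2 : ℂ) *
          eta (z / (z + 1)) ↔
      eta (((a + b : ℤ) * z + b) / ((c + d : ℤ) * z + d)) =
        jacobiSym (c + d) d * e24 (etaExp (a + b) b (c + d) d) *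
          ((c + d : ℤ) * z + d) ^ (1 / 2 : ℂ) * eta z) := by
    intro z hz
    have hz1 : z + 1 ≠ 0 := by
      intro h
      have := congrArg Complex.im h
      simp at this
      exact hz.ne' this
    have hz0 : z ≠ 0 := by rintro rfl; simp at hz
    have hden : ((c + d : ℤ) : ℂ) * z + d ≠ 0 := by
      exact_mod_cast int_den_ne_zero (a := a + b) (b := b) (c := c + d) (d := d)
        (by rw [show (a + b) * (d : ℤ) - b * (c + d) = a * d - b * c by ring, hdet]; simp) hz
    have hx : (c * (z / (z + 1)) + d : ℂ) = ((c + d : ℤ) * z + d) / (z + 1) := by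
      field_simp; push_cast; ring
    have hL : ((a * (z / (z + 1)) + b) / (c * (z / (z + 1)) + d) : ℂ) =
        ((a + b : ℤ) * z + b) / ((c + d : ℤ) * z + d) := by
      rw [hx]
      field_simp; push_cast; ring
    have him : 0 < (z / (z + 1)).im := by
      have := im_moebius_pos (a := 1) (b := 0) (c := 1) (d := 1) (by norm_num) hz
      simpa using this
    have hroot : ((c + d : ℤ) * z + d : ℂ) ^ (1 / 2 : ℂ) =
        (c * (z / (z + 1)) + d) ^ (1 / 2 : ℂ) * (z + 1) ^ (1 / 2 : ℂ) := by
      have hprod : (c * (z / (z + 1)) + d : ℂ) * (z + 1) = (c + d : ℤ) * z + d := by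
        rw [hx, div_mul_cancel₀ _ hz1]
      rw [← hprod]
      apply cpow_half_mul
      · rw [hx]; exact div_ne_zero hden hz1
      · simpa using hz
      · rw [hprod]
        have h1 : (c * (z / (z + 1)) + d : ℂ).im = c * (z / (z + 1)).im := by simp
        rw [h1]
        rcases lt_or_ge c 0 with hc | hc
        · left
          exact mul_neg_of_neg_of_pos (by exact_mod_cast hc) him
        · right
          refine ⟨mul_nonneg (by exact_mod_cast hc) him.le, ?_⟩
          have h2 : (((c + d : ℤ) : ℂ) * z + d).im = (c + d : ℤ) * z.im := by simp
          rw [h2]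
          have : (0 : ℝ) < (c + d : ℤ) := by exact_mod_cast (by omega : 0 < c + (d : ℤ))
          positivity
    -- Since z / (z + 1) = -1 / (z + 1) + 1, this follows from the inversion and translation
    -- formulas.
    have heta : e24 1 * eta (z / (z + 1)) = (z + 1) ^ (1 / 2 : ℂ) * eta z := by
      have h1 := eta_neg_one_div (z := z + 1) (by simpa using hz)
      have h2 := eta_add_one (-1 / (z + 1))
      rw [show -1 / (z + 1) + 1 = z / (z + 1) by field_simp; ring, h1, eta_add_one] at h2
      rw [h2]
      have h3 : e24 1 * (e24 1 * e24 (-3) * e24 1) = 1 := by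
        rw [← e24_add, ← e24_add, ← e24_add]; exact e24_zero
      linear_combination (z + 1) ^ (1 / 2 : ℂ) * eta z * h3
    rw [hL, hroot, hjac, hexp]
    have : ∀ A B C : ℂ, A * (e24 1 * B) * C * eta (z / (z + 1)) =
        A * B * (C * (z + 1) ^ (1 / 2 : ℂ)) * eta z := by
      intro A B C
      linear_combination A * B * C * heta
    rw [this]
  constructor
  · intro h z hz
    have h1 := im_moebius_pos (a := 1) (b := 0) (c := 1) (d := 1) (by norm_num) hz
    exact (key z hz).1 (h _ (by simpa using h1))
  -- The inverse substitution is w ↦ w / (1 - w).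
  · intro h w hw
    have h1 := im_moebius_pos (a := 1) (b := 0) (c := -1) (d := 1) (by norm_num) hw
    have hw1 := int_den_ne_zero (a := 1) (b := 0) (c := -1) (d := 1) (by norm_num) hw
    have h2 := (key _ h1).2 (h _ h1)
    have h3 : (((1 : ℤ) * w + (0 : ℤ)) / ((-1 : ℤ) * w + (1 : ℤ)) : ℂ) /
        (((1 : ℤ) * w + (0 : ℤ)) / ((-1 : ℤ) * w + (1 : ℤ)) + 1) = w := by
      rw [div_add_one hw1, div_div_div_cancel_right₀ hw1]
      push_cast
      ring_nf
    rw [h3] at h2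
    exact h2

theorem etaTransf_iff_add_mul (a b c : ℤ) (d : ℕ) (hd : 0 < d) (hodd : Odd d)
    (hdet : a * d - b * c = 1) (j : ℤ) :
    EtaTransf a b c d ↔ EtaTransf (a + j * b) b (c + j * d) d := by
  induction j using Int.induction_on with
  | zero => simp
  | succ n ih =>
    rw [ih, etaTransf_iff_add _ _ _ d hd hodd (by linear_combination hdet)]
    rw [show a + n * b + b = a + (n + 1) * b by ring, show c + n * d + d = c + (n + 1) * d by ring]
  | pred n ih =>
    rw [ih, etaTransf_iff_add (a + (-n - 1) * b) b (c + (-n - 1) * d) d hd hodd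
      (by linear_combination hdet)]
    rw [show a + (-n - 1) * b + b = a + -n * b by ring,
      show c + (-n - 1) * d + d = c + -n * d by ring]

/-- Quadratic reciprocity with the supplementary law for -1. The sign is written as a 24th root of
unity so that it can be absorbed into `etaExp`. -/
theorem jacobiSym_neg_mul_e24 {d e : ℕ} (hd : Odd d) (he : Odd e) :
    (jacobiSym (-d : ℤ) e : ℂ) * e24 (12 * ((e / 2) * (d / 2) + e / 2)) = jacobiSym e d := by
  have h1 : ((e : ℤ) / 2 * (d / 2) + e / 2) = ((e / 2 * (d / 2) + e / 2 : ℕ) : ℤ) := by push_cast; rfl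
  rw [e24_twelve_mul, h1, zpow_natCast, jacobiSym.quadratic_reciprocity he hd, jacobiSym.neg _ he,
    ZMod.χ₄_eq_neg_one_pow (Nat.odd_iff.1 he), pow_add]
  push_cast
  have h2 : ((-1 : ℂ) ^ (e / 2)) * (-1) ^ (e / 2) = 1 := by rw [← mul_pow]; simp
  linear_combination (-1 : ℂ) ^ (e / 2 * (d / 2)) * jacobiSym d e * h2

theorem jacobiSym_mul_e24 {d e : ℕ} (hd : Odd d) (he : Odd e) :
    (jacobiSym d e : ℂ) * e24 (12 * ((e / 2) * (d / 2) + d / 2)) = jacobiSym (-e : ℤ) d := by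
  have h1 : ((e : ℤ) / 2 * (d / 2) + d / 2) = ((e / 2 * (d / 2) + d / 2 : ℕ) : ℤ) := by push_cast; rfl
  rw [e24_twelve_mul, h1, zpow_natCast, jacobiSym.neg _ hd, jacobiSym.quadratic_reciprocity he hd,
    ZMod.χ₄_eq_neg_one_pow (Nat.odd_iff.1 hd), pow_add]
  push_cast
  ring

/-- In terms of u = -1 / z the matrix (a, b; c, d) acts as (-b, a; -d, c), whose lower right entry
is c = e. This is the descent from d to c, and reciprocity exchanges the two symbols. -/
theorem etaTransf_of_pos {a b c : ℤ} {d e : ℕ} (hd : 0 < d) (hodd : Odd d) (he : Odd e)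
    (hc : c = e) (hdet : a * d - b * c = 1) (h : EtaTransf (-b) a (-d) e) :
    EtaTransf a b c d := by
  subst hc
  intro z hz
  have he0 : 0 < e := he.pos
  have hz0 : z ≠ 0 := by rintro rfl; simp at hz
  have hu : 0 < (-1 / z).im := by
    have := im_moebius_pos (a := 0) (b := -1) (c := 1) (d := 0) (by norm_num) hz
    simpa using this
  have hden : ((e : ℤ) : ℂ) * z + (d : ℤ) ≠ 0 :=
    int_den_ne_zero (a := a) (b := b) (by rw [hdet]; simp) hz
  push_cast at hden
  have hx : ((-d : ℤ) * (-1 / z) + e : ℂ) = (e * z + d) / z := by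
    push_cast; field_simp; ring
  have h1 := h _ hu
  have hL : (((-b : ℤ) * (-1 / z) + a) / ((-d : ℤ) * (-1 / z) + e) : ℂ) =
      (a * z + b) / (e * z + d) := by
    rw [hx]; push_cast; field_simp; ring
  have hroot : (e * z + d : ℂ) ^ (1 / 2 : ℂ) =
      ((-d : ℤ) * (-1 / z) + e) ^ (1 / 2 : ℂ) * z ^ (1 / 2 : ℂ) := by
    rw [← cpow_half_mul _ hz, hx, div_mul_cancel₀ _ hz0]
    · left
      have : (((-d : ℤ) : ℂ) * (-1 / z) + e).im = (-d : ℤ) * (-1 / z).im := by simp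
      rw [this]
      exact mul_neg_of_neg_of_pos (by exact_mod_cast (by omega : (-d : ℤ) < 0)) hu
    · rw [hx]; exact div_ne_zero hden hz0
  rw [hL, eta_neg_one_div hz] at h1
  push_cast
  rw [h1, hroot]
  have hkey : (jacobiSym (-d : ℤ) e : ℂ) * e24 (etaExp (-b) a (-d) e) * e24 (-3) =
      jacobiSym e d * e24 (etaExp a b e d) := by
    have hrec : (jacobiSym (-d : ℤ) e : ℂ) * e24 (12 * ((e / 2) * (d / 2) + e / 2)) =
        jacobiSym e d := jacobiSym_neg_mul_e24 hodd he
    rw [← hrec, mul_assoc, mul_assoc, ← e24_add, ← e24_add]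
    congr 1
    apply e24_congr
    obtain ⟨m, rfl⟩ := he
    obtain ⟨n, rfl⟩ := hodd
    have h1 : ((2 * m + 1 : ℕ) : ℤ) / 2 = m := by omega
    have h2 : ((2 * n + 1 : ℕ) : ℤ) / 2 = n := by omega
    rw [h1, h2]
    simp only [etaExp]
    push_cast at hdet ⊢
    exact ⟨0, by linear_combination (-(2 * m + 1) * (2 * n + 1) : ℤ) * hdet⟩
  linear_combination ((-d : ℤ) * (-1 / z) + e) ^ (1 / 2 : ℂ) * z ^ (1 / 2 : ℂ) * eta z * hkey

/-- For c = -e < 0 the matrix in u = -1 / z must be negated to get the positive entry e. The negated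
denominator accounts for the factor i from `neg_cpow_half`. -/
theorem etaTransf_of_neg {a b c : ℤ} {d e : ℕ} (hd : 0 < d) (hodd : Odd d) (he : Odd e)
    (hc : c = -e) (hdet : a * d - b * c = 1) (h : EtaTransf b (-a) d e) :
    EtaTransf a b c d := by
  subst hc
  intro z hz
  have he0 : 0 < e := he.pos
  have hz0 : z ≠ 0 := by rintro rfl; simp at hz
  have hu : 0 < (-1 / z).im := by
    have := im_moebius_pos (a := 0) (b := -1) (c := 1) (d := 0) (by norm_num) hz
    simpa using this
  have hden : ((-e : ℤ) : ℂ) * z + (d : ℤ) ≠ 0 :=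
    int_den_ne_zero (a := a) (b := b) (by rw [hdet]; simp) hz
  push_cast at hden
  have hx : ((d : ℤ) * (-1 / z) + e : ℂ) = -(-e * z + d) / z := by
    push_cast; field_simp; ring
  have h1 := h _ hu
  have hL : ((b * (-1 / z) + (-a : ℤ)) / ((d : ℤ) * (-1 / z) + e) : ℂ) =
      (a * z + b) / (-e * z + d) := by
    rw [hx]; push_cast
    have : (b * (-1 / z) + -a : ℂ) = -(a * z + b) / z := by field_simp; ring
    rw [this, div_div_div_cancel_right₀ hz0, neg_div_neg_eq]
  have him : (-e * z + d : ℂ).im < 0 := by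
    simp
    positivity
  have hroot : Complex.I * (-e * z + d : ℂ) ^ (1 / 2 : ℂ) =
      ((d : ℤ) * (-1 / z) + e) ^ (1 / 2 : ℂ) * z ^ (1 / 2 : ℂ) := by
    rw [← cpow_half_mul _ hz, hx, div_mul_cancel₀ _ hz0, neg_cpow_half him]
    · right
      have : (((d : ℤ) : ℂ) * (-1 / z) + e).im = (d : ℤ) * (-1 / z).im := by simp
      rw [this]
      refine ⟨mul_nonneg (by simp) hu.le, ?_⟩
      rw [hx, div_mul_cancel₀ _ hz0, Complex.neg_im]
      linarith
    · rw [hx]; exact div_ne_zero (neg_ne_zero.2 hden) hz0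
  rw [hL, eta_neg_one_div hz] at h1
  push_cast
  rw [h1]
  have hkey : (jacobiSym d e : ℂ) * e24 (etaExp b (-a) d e) * e24 3 =
      jacobiSym (-e) d * e24 (etaExp a b (-e) d) := by
    have hrec : (jacobiSym d e : ℂ) * e24 (12 * ((e / 2) * (d / 2) + d / 2)) =
        jacobiSym (-e) d := jacobiSym_mul_e24 hodd he
    rw [← hrec, mul_assoc, mul_assoc, ← e24_add, ← e24_add]
    congr 1
    apply e24_congr
    obtain ⟨m, rfl⟩ := he
    obtain ⟨n, rfl⟩ := hodd
    have h1 : ((2 * m + 1 : ℕ) : ℤ) / 2 = m := by omega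
    have h2 : ((2 * n + 1 : ℕ) : ℤ) / 2 = n := by omega
    rw [h1, h2]
    simp only [etaExp]
    push_cast at hdet ⊢
    exact ⟨-(m * n + n), by linear_combination ((2 * m + 1) * (2 * n + 1) : ℤ) * hdet⟩
  have h6 : e24 3 = e24 (-3) * Complex.I := by rw [← e24_six, ← e24_add]; rfl
  rw [h6] at hkey
  linear_combination (-e24 (-3) * jacobiSym d e * e24 (etaExp b (-a) d e) * eta z) * hroot +
    (-e * z + d : ℂ) ^ (1 / 2 : ℂ) * eta z * hkey

/-- The transformation formula of the Dedekind eta function under `(a, b; c, d) ∈ SL(2, ℤ)` with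
odd `d > 0`. -/
theorem etaTransf (d : ℕ) (hodd : Odd d) (a b c : ℤ) (hdet : a * d - b * c = 1) :
    EtaTransf a b c d := by
  induction d using Nat.strong_induction_on generalizing a b c with
  | _ d ih =>
  have hd : 0 < d := hodd.pos
  rcases (Nat.one_le_iff_ne_zero.2 hd.ne').eq_or_lt with rfl | hd1
  · rw [etaTransf_iff_add_mul a b c 1 hd hodd hdet (-c)]
    have h1 : a + -c * b = 1 := by push_cast at hdet; linear_combination hdet
    have h2 : c + -c * (1 : ℕ) = 0 := by push_cast; ring
    rw [h1, h2]
    intro z hz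
    have h3 : etaExp 1 b 0 (1 : ℕ) = b := by simp [etaExp]
    rw [h3]
    simp [eta_add_int]
  -- Euclidean step: as d is odd, exactly one of c % d and c % d - d is odd. In the second case c %
  -- d ≠ 0, because c and d are coprime and d > 1, so the absolute value stays below d.
  · obtain ⟨j, hj⟩ : ∃ j : ℤ, Odd (c + j * d) ∧ (c + j * d).natAbs < d := by
      have h1 := Int.emod_nonneg c (by omega : (d : ℤ) ≠ 0)
      have h2 := Int.emod_lt_of_pos c (by omega : (0 : ℤ) < d)
      have h3 := Int.emod_add_mul_ediv c d
      rcases Int.even_or_odd (c % d) with h4 | h4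
      · refine ⟨-(c / d) - 1, ?_⟩
        rw [show c + (-(c / d) - 1) * d = c % d - d by linear_combination -h3]
        refine ⟨h4.sub_odd (by exact_mod_cast hodd), ?_⟩
        have : c % d ≠ 0 := by
          intro h5
          have h6 : (d : ℤ) ∣ 1 := by
            rw [← hdet]
            exact dvd_sub (dvd_mul_left _ _) ((Int.dvd_of_emod_eq_zero h5).mul_left _)
          have := Int.le_of_dvd one_pos h6
          omega
        omega
      · refine ⟨-(c / d), ?_⟩
        rw [show c + -(c / d) * d = c % d by linear_combination -h3]
        exact ⟨h4, by omega⟩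
    rw [etaTransf_iff_add_mul a b c d hd hodd hdet j]
    have hdet' : (a + j * b) * d - b * (c + j * d) = 1 := by linear_combination hdet
    generalize a + j * b = a' at *
    generalize c + j * d = c' at *
    obtain ⟨hc1, hc2⟩ := hj
    have hcn : Odd c'.natAbs := Int.natAbs_odd.2 hc1
    rcases le_or_gt 0 c' with hc | hc
    · have h0 : c' = c'.natAbs := by omega
      refine etaTransf_of_pos hd hodd hcn h0 hdet' (ih _ (by omega) hcn _ _ _ ?_)
      rw [← h0]; linear_combination hdet'
    · have h0 : c' = -c'.natAbs := by omega
      refine etaTransf_of_neg hd hodd hcn h0 hdet' (ih _ (by omega) hcn _ _ _ ?_)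
      have : (c'.natAbs : ℤ) = -c' := by omega
      rw [this]; linear_combination hdet'

end EtaQuotient

end

noncomputable section

namespace EtaQuotient

/-! ### Modular forms as functions of a complex variable -/

/-- `F` grows at most like a form of weight `w / 2` at every cusp. -/
def BoundedAtCusps (w : ℤ) (F : ℂ → ℂ) : Prop :=
  ∀ a b c d : ℤ, a * d - b * c = 1 → ∃ C A : ℝ, ∀ z : ℂ, 0 < z.im → A ≤ z.im →
    ‖F ((a * z + b) / (c * z + d))‖ ≤ C * Real.sqrt ‖c * z + d‖ ^ w

theorem BoundedAtCusps.add {w : ℤ} {F G : ℂ → ℂ} (hF : BoundedAtCusps w F)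
    (hG : BoundedAtCusps w G) : BoundedAtCusps w (fun z => F z + G z) := by
  intro a b c d h
  obtain ⟨C, A, h1⟩ := hF a b c d h
  obtain ⟨C', A', h2⟩ := hG a b c d h
  refine ⟨C + C', max A A', fun z hz hA => ?_⟩
  rw [add_mul]
  exact (norm_add_le _ _).trans (add_le_add (h1 z hz ((le_max_left _ _).trans hA))
    (h2 z hz ((le_max_right _ _).trans hA)))

theorem BoundedAtCusps.const_mul {w : ℤ} {F : ℂ → ℂ} (hF : BoundedAtCusps w F) (k : ℂ) :
    BoundedAtCusps w (fun z => k * F z) := by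
  intro a b c d h
  obtain ⟨C, A, h1⟩ := hF a b c d h
  refine ⟨‖k‖ * C, A, fun z hz hA => ?_⟩
  rw [norm_mul, mul_assoc]
  exact mul_le_mul_of_nonneg_left (h1 z hz hA) (norm_nonneg _)

theorem BoundedAtCusps.sum {w : ℤ} {ι : Type*} (s : Finset ι) {F : ι → ℂ → ℂ}
    (hF : ∀ i ∈ s, BoundedAtCusps w (F i)) : BoundedAtCusps w (fun z => ∑ i ∈ s, F i z) := by
  classical
  induction s using Finset.induction_on with
  | empty =>
    intro a b c d _
    exact ⟨0, 0, fun z _ _ => by simp⟩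
  | insert i s hi ih =>
    simp only [Finset.sum_insert hi]
    exact (hF i (by simp)).add (ih fun j hj => hF j (by simp [hj]))

/-- Growth at the cusps is preserved by substituting `(A z + B) / D`. -/
theorem BoundedAtCusps.comp {w : ℤ} {F : ℂ → ℂ} (hF : BoundedAtCusps w F) {A D : ℤ} (B : ℤ)
    (hA : 0 < A) (hD : 0 < D) : BoundedAtCusps w (fun z => F ((A * z + B) / D)) := by
  intro a b c d h
  have hne : A * a + B * c ≠ 0 ∨ D * c ≠ 0 := by
    by_contra! hcon
    obtain ⟨h1, h2⟩ := hcon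
    have hc : c = 0 := by
      rcases mul_eq_zero.1 h2 with h3 | h3
      · exact absurd h3 hD.ne'
      · exact h3
    subst hc
    have ha : a = 0 := by
      rcases mul_eq_zero.1 (by simpa using h1 : A * a = 0) with h3 | h3
      · exact absurd h3 hA.ne'
      · exact h3
    simp [ha] at h
  -- Hermite normal form: (A, B; 0, D)·γ = γ'·(g, B'; 0, D') with γ' ∈ SL(2, ℤ), where g is the gcd
  -- of the first column on the left.
  obtain ⟨g, a', c', hg, hcop, h1, h2⟩ : ∃ g a' c' : ℤ, 0 < g ∧ IsCoprime a' c' ∧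
      A * a + B * c = g * a' ∧ D * c = g * c' := by
    have h0 : 0 < Int.gcd (A * a + B * c) (D * c) := by
      rw [Int.gcd_pos_iff]; exact hne
    obtain ⟨x, y, hxy, h1, h2⟩ := Int.exists_gcd_one h0
    exact ⟨Int.gcd (A * a + B * c) (D * c), x, y, by exact_mod_cast h0,
      Int.isCoprime_iff_gcd_eq_one.2 hxy, h1.trans (mul_comm _ _), h2.trans (mul_comm _ _)⟩
  obtain ⟨d', b', hdb⟩ := hcop
  have hdet : a' * d' - (-b') * c' = 1 := by linear_combination hdb
  set B' : ℤ := d' * (A * b + B * d) + b' * (D * d) with hB'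
  set D' : ℤ := a' * (D * d) - c' * (A * b + B * d) with hD'
  have hgD : g * D' = A * D := by
    rw [hD']
    linear_combination A * D * h - (D * d) * h1 + (A * b + B * d) * h2
  have hD'0 : 0 < D' := pos_of_mul_pos_right (by rw [hgD]; positivity) hg.le
  have e1 : A * b + B * d = a' * B' + (-b') * D' := by
    rw [hB', hD']; linear_combination -(A * b + B * d) * hdb
  have e2 : D * d = c' * B' + d' * D' := by
    rw [hB', hD']; linear_combination -(D * d) * hdb
  obtain ⟨C, A0, hbd⟩ := hF a' (-b') c' d' hdet
  refine ⟨C * Real.sqrt (D / D') ^ w, A0 * D' / g, fun z hz hzA => ?_⟩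
  have hgR : (0 : ℝ) < g := by exact_mod_cast hg
  have hDR : (0 : ℝ) < D := by exact_mod_cast hD
  have hD'R : (0 : ℝ) < D' := by exact_mod_cast hD'0
  have hDC : (D : ℂ) ≠ 0 := by exact_mod_cast hD.ne'
  have hD'C : (D' : ℂ) ≠ 0 := by exact_mod_cast hD'0.ne'
  have him : ((g * z + B') / D' : ℂ).im = g * z.im / D' := by
    rw [show (D' : ℂ) = ((D' : ℝ) : ℂ) by simp, Complex.div_ofReal_im]
    simp
  have hden : (c : ℂ) * z + d ≠ 0 := int_den_ne_zero (by rw [h]; simp) hz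
  have h1C : (A : ℂ) * a + B * c = g * a' := by exact_mod_cast h1
  have h2C : (D : ℂ) * c = g * c' := by exact_mod_cast h2
  have e1C : (A : ℂ) * b + B * d = a' * B' + -b' * D' := by exact_mod_cast e1
  have e2C : (D : ℂ) * d = c' * B' + d' * D' := by exact_mod_cast e2
  have hw : (c' : ℂ) * ((g * z + B') / D') + d' = (D / D') * (c * z + d) := by
    field_simp
    linear_combination -z * h2C - e2C
  have hnum : (a' : ℂ) * ((g * z + B') / D') + (-b' : ℤ) =
      (A * (a * z + b) + B * (c * z + d)) / D' := by
    push_cast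
    field_simp
    linear_combination -z * h1C - e1C
  have := hbd ((g * z + B') / D') (by rw [him]; positivity) (by
    rw [him, le_div_iff₀ hD'R]
    rw [div_le_iff₀ hgR] at hzA
    linarith)
  have hpt : ((A * ((a * z + b) / (c * z + d)) + B) / D : ℂ) =
      (A * (a * z + b) + B * (c * z + d)) / D' / ((D / D') * (c * z + d)) := by
    generalize (a * z + b : ℂ) = X
    generalize (c * z + d : ℂ) = Y at hden
    field_simp
  rw [hw, hnum, ← hpt] at this
  refine this.trans (le_of_eq ?_)
  rw [norm_mul, Real.sqrt_mul (norm_nonneg _), mul_zpow, mul_assoc]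
  congr 4
  rw [norm_div, Complex.norm_intCast, Complex.norm_intCast, abs_of_pos hDR, abs_of_pos hD'R]

/-- The parameter `q = exp (2 π i z)`. -/
def qExp (z : ℂ) : ℂ := Complex.exp (2 * Real.pi * Complex.I * z)

theorem qExp_add_int (z : ℂ) (n : ℤ) : qExp (z + n) = qExp z := by
  rw [qExp, qExp, mul_add, Complex.exp_add]
  have : Complex.exp (2 * Real.pi * Complex.I * n) = 1 :=
    Complex.exp_eq_one_iff.2 ⟨n, by ring⟩
  rw [this, mul_one]

theorem qExp_pow (z : ℂ) (n : ℕ) : qExp z ^ n = qExp (n * z) := by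
  rw [qExp, qExp, ← Complex.exp_nat_mul]
  ring_nf

/-- `F` is, on the upper half plane, a holomorphic form of weight `w / 2` with Fourier
coefficients `A n`, and its multiplier on the matrices `(a, b; N c, d)` of determinant one with
`c, d > 0` is `μ c d`. -/
structure IsForm (N : ℕ) (w : ℤ) (μ : ℤ → ℤ → ℂ) (F : ℂ → ℂ) (A : ℕ → ℂ) : Prop where
  diff : DifferentiableOn ℂ F {z | 0 < z.im}
  transf : ∀ a b c d : ℤ, 0 < c → 0 < d → a * d - b * (N * c) = 1 → ∀ z : ℂ, 0 < z.im →
    F ((a * z + b) / (N * c * z + d)) = μ c d * ((N * c * z + d) ^ (1 / 2 : ℂ)) ^ w * F z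
  bdd : BoundedAtCusps w F
  hasSum : ∀ z : ℂ, 0 < z.im → HasSum (fun n => A n * qExp z ^ n) (F z)

namespace IsForm

variable {N : ℕ} {w : ℤ} {μ : ℤ → ℤ → ℂ} {F : ℂ → ℂ} {A : ℕ → ℂ}

theorem add_int (hF : IsForm N w μ F A) {z : ℂ} (hz : 0 < z.im) (n : ℤ) : F (z + n) = F z := by
  have h1 := hF.hasSum (z + n) (by simpa using hz)
  simp only [qExp_add_int] at h1
  exact h1.unique (hF.hasSum z hz)

/-- `F ((z + B) / l)` only depends on `B` modulo `l`. -/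
theorem add_div_congr (hF : IsForm N w μ F A) {z : ℂ} (hz : 0 < z.im) {l : ℕ} (hl : 0 < l)
    {B B' : ℤ} (h : (B : ZMod l) = B') : F ((z + B) / l) = F ((z + B') / l) := by
  rw [ZMod.intCast_eq_intCast_iff_dvd_sub] at h
  obtain ⟨t, ht⟩ := h
  have hl0 : (l : ℂ) ≠ 0 := by exact_mod_cast hl.ne'
  have him : 0 < ((z + B) / l : ℂ).im := by
    rw [show (l : ℂ) = ((l : ℝ) : ℂ) by simp, Complex.div_ofReal_im]
    simp
    positivity
  rw [← hF.add_int him t]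
  congr 1
  have : (B' : ℂ) - B = l * t := by exact_mod_cast ht
  field_simp
  linear_combination -this

end IsForm

/-! ### The q-expansions of averages over translates and of F(p z) -/

/-- The average over `x` modulo `l` of `exp (2 π i n x / l)`. -/
theorem sum_qExp_div {l : ℕ} [NeZero l] (n : ℕ) :
    ∑ x : ZMod l, qExp (n * x.val / l) = if l ∣ n then (l : ℂ) else 0 := by
  have hl0 : (l : ℂ) ≠ 0 := by exact_mod_cast NeZero.ne l
  have hs : ∑ x : ZMod l, qExp (n * x.val / l) = ∑ i ∈ Finset.range l, qExp (n / l) ^ i := by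
    have h1 : ∀ x : ZMod l, qExp (n * x.val / l) = qExp (n / l) ^ x.val := fun x => by
      rw [qExp_pow]; congr 1; ring
    simp only [h1]
    refine Finset.sum_bij (fun x _ => x.val) (fun x _ => Finset.mem_range.2 x.val_lt)
      (fun x _ y _ h => ZMod.val_injective l h) (fun i hi => ?_) (fun _ _ => rfl)
    exact ⟨i, Finset.mem_univ _, ZMod.val_natCast_of_lt (Finset.mem_range.1 hi)⟩
  rw [hs]
  have hpow : qExp (n / l) ^ l = 1 := by
    rw [qExp_pow, mul_div_cancel₀ _ hl0, qExp, Complex.exp_eq_one_iff]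
    exact ⟨n, by push_cast; ring⟩
  split_ifs with h
  · obtain ⟨m, rfl⟩ := h
    have : qExp (((l * m : ℕ) : ℂ) / l) = 1 := by
      rw [qExp, Complex.exp_eq_one_iff]
      exact ⟨m, by push_cast; field_simp⟩
    rw [this]
    simp
  · have hne : qExp (n / l) ≠ 1 := by
      rw [qExp, Ne, Complex.exp_eq_one_iff]
      rintro ⟨m, hm⟩
      apply h
      have h2 : (2 * Real.pi * Complex.I : ℂ) ≠ 0 := Complex.two_pi_I_ne_zero
      have h3 : (n : ℂ) / l = m := mul_left_cancel₀ h2 (by rw [hm]; ring)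
      rw [div_eq_iff hl0] at h3
      have h4 : (n : ℤ) = m * l := by exact_mod_cast h3
      exact Int.natCast_dvd_natCast.1 ⟨m, by rw [h4]; ring⟩
    rw [geom_sum_eq hne, hpow]
    simp

theorem im_add_div_pos {z : ℂ} (hz : 0 < z.im) (B : ℤ) {l : ℕ} (hl : 0 < l) :
    0 < ((z + B) / l : ℂ).im := by
  rw [show (l : ℂ) = ((l : ℝ) : ℂ) by simp, Complex.div_ofReal_im]
  simp
  positivity

/-- The `q`-expansion of `(1 / l) ∑ F ((z + x) / l)`. -/
theorem hasSum_average {F : ℂ → ℂ} {A : ℕ → ℂ}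
    (h : ∀ z : ℂ, 0 < z.im → HasSum (fun n => A n * qExp z ^ n) (F z)) (l : ℕ) [NeZero l]
    {z : ℂ} (hz : 0 < z.im) :
    HasSum (fun n => A (l * n) * qExp z ^ n) ((l : ℂ)⁻¹ * ∑ x : ZMod l, F ((z + x.val) / l)) := by
  have hl : 0 < l := NeZero.pos l
  have hl0 : (l : ℂ) ≠ 0 := by exact_mod_cast hl.ne'
  have h1 : HasSum (fun n => (l : ℂ)⁻¹ * ∑ x : ZMod l, A n * qExp ((z + x.val) / l) ^ n)
      ((l : ℂ)⁻¹ * ∑ x : ZMod l, F ((z + x.val) / l)) := by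
    refine HasSum.mul_left _ (hasSum_sum fun x _ => h _ ?_)
    exact_mod_cast im_add_div_pos hz x.val hl
  have h2 : ∀ n, (l : ℂ)⁻¹ * ∑ x : ZMod l, A n * qExp ((z + x.val) / l) ^ n =
      if l ∣ n then A n * qExp (n * z / l) else 0 := by
    intro n
    have h3 : ∀ x : ZMod l, A n * qExp ((z + x.val) / l) ^ n =
        A n * qExp (n * z / l) * qExp (n * x.val / l) := fun x => by
      rw [qExp_pow, mul_assoc]
      congr 1
      rw [qExp, qExp, qExp, ← Complex.exp_add]
      ring_nf
    simp only [h3]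
    rw [← Finset.mul_sum, sum_qExp_div]
    split_ifs
    · field_simp
    · simp
  simp only [h2] at h1
  have hinj : Function.Injective (fun n : ℕ => l * n) := fun a b hab =>
    Nat.eq_of_mul_eq_mul_left hl hab
  rw [← hinj.hasSum_iff] at h1
  · convert h1 using 2 with n
    simp only [Function.comp, dvd_mul_right, if_true]
    rw [qExp_pow]
    congr 2
    push_cast
    field_simp
  · intro n hn
    rw [if_neg]
    rintro ⟨m, rfl⟩
    exact hn ⟨m, rfl⟩

/-- The `q`-expansion of `F (p z)`. -/
theorem hasSum_comp_mul {F : ℂ → ℂ} {A : ℕ → ℂ}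
    (h : ∀ z : ℂ, 0 < z.im → HasSum (fun n => A n * qExp z ^ n) (F z)) {p : ℕ} (hp : 0 < p)
    {z : ℂ} (hz : 0 < z.im) :
    HasSum (fun n => (if p ∣ n then A (n / p) else 0) * qExp z ^ n) (F (p * z)) := by
  have h1 := h (p * z) (by simpa using mul_pos (Nat.cast_pos.2 hp) hz)
  have hinj : Function.Injective (fun n : ℕ => p * n) := fun a b hab =>
    Nat.eq_of_mul_eq_mul_left hp hab
  rw [← hinj.hasSum_iff]
  · convert h1 using 2 with n
    simp only [Function.comp, dvd_mul_right, if_true, Nat.mul_div_cancel_left n hp]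
    rw [qExp_pow, qExp_pow]
    congr 2
    push_cast
    ring
  · intro n hn
    rw [if_neg, zero_mul]
    rintro ⟨m, rfl⟩
    exact hn ⟨m, rfl⟩

end EtaQuotient

end

/-! ### The operator U_l for l dividing a power of the level -/

noncomputable section

namespace EtaQuotient

/-- Integers in a prescribed class modulo `l` may be chosen nonpositive and divisible by `h`. -/
theorem exists_nonpos_lift {h l : ℕ} [NeZero l] (hc : Nat.Coprime h l) (r : ZMod l) :
    ∃ B : ℤ, (B : ZMod l) = r ∧ (h : ℤ) ∣ B ∧ B ≤ 0 := by
  refine ⟨h * ((r * (h : ZMod l)⁻¹).val - l), ?_, dvd_mul_right _ _, ?_⟩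
  · push_cast
    rw [ZMod.natCast_zmod_val, ZMod.natCast_self, sub_zero, mul_left_comm,
      ZMod.coe_mul_inv_eq_one h hc, mul_one]
  · have := (r * (h : ZMod l)⁻¹).val_lt
    exact mul_nonpos_of_nonneg_of_nonpos (by positivity) (by omega)

theorem intCast_isUnit {l : ℕ} {n : ℤ} (h : IsCoprime n l) : IsUnit (n : ZMod l) :=
  (ZMod.coe_int_isUnit_iff_isCoprime n l).2 h.symm

theorem differentiableOn_comp_affine {F : ℂ → ℂ} (hF : DifferentiableOn ℂ F {z | 0 < z.im})
    {u : ℂ → ℂ} (hu : Differentiable ℂ u) (him : ∀ z : ℂ, 0 < z.im → 0 < (u z).im) :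
    DifferentiableOn ℂ (fun z => F (u z)) {z | 0 < z.im} :=
  hF.comp hu.differentiableOn him

namespace IsForm

variable {N : ℕ} {w : ℤ} {μ μ' : ℤ → ℤ → ℂ} {F : ℂ → ℂ} {A : ℕ → ℂ}

/-- The action of `(a, b; N c, d)` on `F ((z + B) / l)`, when the outcome is of the same shape. -/
theorem transf_add_div (hF : IsForm N w μ F A) {l : ℕ} (hl : 0 < l) {a b c d B B' : ℤ}
    (hc : 0 < c) (hd : 0 < d) (hdet : a * d - b * (N * c) = 1) (hB' : B' ≤ 0)
    (hcong : ((a + B * (N * c)) * B' - (b + B * d) : ℤ) ≡ 0 [ZMOD l]) {z : ℂ} (hz : 0 < z.im) :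
    F (((a * z + b) / (N * c * z + d) + B) / l) =
      μ (l * c) (d - N * c * B') * ((N * c * z + d) ^ (1 / 2 : ℂ)) ^ w * F ((z + B') / l) := by
  obtain ⟨e, he⟩ := Int.modEq_zero_iff_dvd.1 hcong
  have hl0 : (l : ℂ) ≠ 0 := by exact_mod_cast hl.ne'
  have hden : (N * c * z + d : ℂ) ≠ 0 := by
    have := int_den_ne_zero (a := a) (b := b) (c := N * c) (d := d) (by rw [hdet]; simp) hz
    exact_mod_cast this
  -- The matrix γ' with (1, B; 0, l)·(a, b; N c, d) = γ'·(1, B'; 0, l). The congruence makes its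
  -- upper right entry integral, and B' ≤ 0 keeps its lower right entry positive.
  have h1 := hF.transf (a + B * (N * c)) (-e) (l * c) (d - N * c * B')
    (by positivity)
    (by nlinarith [mul_nonneg (mul_nonneg (Int.natCast_nonneg N) hc.le) (neg_nonneg.2 hB')])
    (by linear_combination hdet - N * c * he) ((z + B') / l) (im_add_div_pos hz B' hl)
  have e1 : (N * (l * c : ℤ) * ((z + B') / l) + (d - N * c * B' : ℤ) : ℂ) = N * c * z + d := by
    push_cast; field_simp; ring
  have heC : ((a + B * (N * c)) * B' - (b + B * d) : ℂ) = l * e := by exact_mod_cast he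
  have e2 : ((a + B * (N * c) : ℤ) * ((z + B') / l) + (-e : ℤ) : ℂ) =
      ((a * z + b) + B * (N * c * z + d)) / l := by
    push_cast; field_simp
    linear_combination heC
  rw [e1, e2] at h1
  rw [← h1]
  congr 1
  generalize (a * z + b : ℂ) = X
  generalize (N * c * z + d : ℂ) = Y at hden
  field_simp

theorem differentiableOn_average (hF : IsForm N w μ F A) (l : ℕ) [NeZero l] :
    DifferentiableOn ℂ (fun z => (l : ℂ)⁻¹ * ∑ x : ZMod l, F ((z + x.val) / l))
      {z | 0 < z.im} := by
  refine (DifferentiableOn.fun_sum fun x _ => ?_).const_mul _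
  refine differentiableOn_comp_affine hF.diff (by fun_prop) fun z hz => ?_
  exact_mod_cast im_add_div_pos hz x.val (NeZero.pos l)

theorem boundedAtCusps_average (hF : IsForm N w μ F A) (l : ℕ) [NeZero l] :
    BoundedAtCusps w (fun z => (l : ℂ)⁻¹ * ∑ x : ZMod l, F ((z + x.val) / l)) := by
  refine (BoundedAtCusps.sum _ fun x _ => ?_).const_mul _
  have := hF.bdd.comp (A := 1) (D := l) x.val one_pos (by exact_mod_cast NeZero.pos l)
  simpa using this

/-- The operator `U_l` for `l` dividing a power of the level. -/
theorem average (hF : IsForm N w μ F A) (l h : ℕ) [NeZero l] {n : ℕ} (hlN : l ∣ N ^ n)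
    (hh : Nat.Coprime h l)
    (hμ : ∀ c d B : ℤ, 0 < c → 0 < d → IsCoprime d (N * c) → (h : ℤ) ∣ B → B ≤ 0 →
      μ (l * c) (d - N * c * B) = μ' c d) :
    IsForm N w μ' (fun z => (l : ℂ)⁻¹ * ∑ x : ZMod l, F ((z + x.val) / l))
      (fun n => A (l * n)) where
  diff := hF.differentiableOn_average l
  bdd := hF.boundedAtCusps_average l
  hasSum z hz := hasSum_average hF.hasSum l hz
  transf a b c d hc hd hdet z hz := by
    have hl : 0 < l := NeZero.pos l
    have hcop : IsCoprime d ((N : ℤ) * c) := ⟨a, -b, by linear_combination hdet⟩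
    have hdetl : (a * d - b * (N * c) : ZMod l) = 1 := by
      exact_mod_cast congrArg (Int.cast : ℤ → ZMod l) hdet
    have key : ∀ x : ZMod l, ∃ y : ZMod l, (a + x * (N * c)) * y = b + x * d ∧
        F (((a * z + b) / (N * c * z + d) + x.val) / l) =
          μ' c d * ((N * c * z + d) ^ (1 / 2 : ℂ)) ^ w * F ((z + y.val) / l) := by
      intro x
      have hu : IsUnit ((a + x.val * (N * c) : ℤ) : ZMod l) := by
        apply intCast_isUnit
        have h1 : IsCoprime (a + x.val * (N * c)) (N : ℤ) :=
          ⟨d, -(b + x.val * d) * c, by linear_combination hdet⟩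
        have h2 : ((l : ℤ)) ∣ (N : ℤ) ^ n := by exact_mod_cast hlN
        exact (h1.pow_right (n := n)).of_isCoprime_of_dvd_right h2
      obtain ⟨u, hu⟩ := hu
      obtain ⟨B', hB1, hB2, hB3⟩ := exists_nonpos_lift hh (↑u⁻¹ * (b + x * d) : ZMod l)
      have hrel : (a + x * (N * c)) * (B' : ZMod l) = b + x * d := by
        have h3 : (a + x * (N * c) : ZMod l) = u := by
          rw [hu]; push_cast; rw [ZMod.natCast_zmod_val]
        rw [h3, hB1, ← mul_assoc, Units.mul_inv, one_mul]
      refine ⟨(B' : ZMod l), hrel, ?_⟩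
      have h4 := hF.transf_add_div hl (B := x.val) hc hd hdet hB3 (by
        rw [← ZMod.intCast_eq_intCast_iff]
        push_cast
        rw [ZMod.natCast_zmod_val, hrel, sub_self]) hz
      rw [hμ c d B' hc hd hcop hB2 hB3] at h4
      have h5 := hF.add_div_congr hz hl (B := B') (B' := ((B' : ZMod l).val : ℤ)) (by simp)
      rw [h5] at h4
      exact_mod_cast h4
    choose σ hσ1 hσ2 using key
    have hinj : Function.Injective σ := by
      intro x y hxy
      have h1 := hσ1 x
      have h2 := hσ1 y
      rw [hxy] at h1
      -- Determinant one makes d - N c σ(y) inverse to a + x N c modulo l, so σ(x) determines x.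
      have h3 : (d - N * c * σ y) * (a + x * (N * c)) = (1 : ZMod l) := by
        linear_combination hdetl - N * c * h1
      have h4 : (x - y) * (d - N * c * σ y) = 0 := by linear_combination h2 - h1
      have h5 : x - y = 0 := by
        linear_combination (a + x * (N * c)) * h4 - (x - y) * h3
      exact sub_eq_zero.1 h5
    simp only [hσ2]
    rw [← Finset.mul_sum, (Finite.injective_iff_bijective.1 hinj).sum_comp
      (fun y => F ((z + y.val) / l))]
    ring

end IsForm

end EtaQuotient

end

/-! ### The Hecke operator T_p in integral weight -/

noncomputable section

namespace EtaQuotient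

/-- `ψ` is multiplicative and `M`-periodic on the positive integers coprime to `N`. -/
structure IsChar (N M : ℕ) (ψ : ℤ → ℂ) : Prop where
  mul : ∀ a b : ℤ, 0 < a → 0 < b → IsCoprime a (N : ℤ) → IsCoprime b (N : ℤ) →
    ψ (a * b) = ψ a * ψ b
  periodic : ∀ a b : ℤ, 0 < a → 0 < b → IsCoprime a (N : ℤ) → (M : ℤ) ∣ a - b → ψ a = ψ b

theorem cpow_half_zpow (x : ℂ) (k : ℤ) : (x ^ (1 / 2 : ℂ)) ^ (2 * k) = x ^ k := by
  rw [zpow_mul]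
  congr 1
  rw [show (2 : ℤ) = ((2 : ℕ) : ℤ) by rfl, zpow_natCast, one_div]
  exact Complex.cpow_ofNat_inv_pow x 2

namespace IsForm

variable {N : ℕ} {k : ℤ} {μ : ℤ → ℤ → ℂ} {F : ℂ → ℂ} {A : ℕ → ℂ}

/-- The operator `T_p` for a prime `p` not dividing the level, in integral weight. -/
def hecke (k : ℤ) (p : ℕ) [NeZero p] (t : ℂ) (F : ℂ → ℂ) (z : ℂ) : ℂ :=
  (p : ℂ)⁻¹ * ∑ x : ZMod p, F ((z + x.val) / p) + t * (p : ℂ) ^ (k - 1) * F (p * z)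

/-- The terms of the Hecke operator, indexed by the projective line over `ZMod p`. -/
def heckeTerm (k : ℤ) (p : ℕ) (t : ℂ) (F : ℂ → ℂ) (z : ℂ) : Option (ZMod p) → ℂ
  | none => t * (p : ℂ) ^ k * F (p * z)
  | some x => F ((z + x.val) / p)

theorem hecke_eq_sum (p : ℕ) [NeZero p] (t : ℂ) (F : ℂ → ℂ) (z : ℂ) :
    hecke k p t F z = (p : ℂ)⁻¹ * ∑ o, heckeTerm k p t F z o := by
  have hp : (p : ℂ) ≠ 0 := by exact_mod_cast NeZero.ne p
  rw [Fintype.sum_option, hecke]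
  simp only [heckeTerm]
  rw [zpow_sub_one₀ hp]
  ring

/-- The p + 1 matrices (1, x; 0, p) and (p, 0; 0, 1) are permuted, up to left factors in Γ₀(N), as
the points of the projective line over `ZMod p`, with `none` as ∞. The `match` records the image
point so that bijectivity can be deduced. Representatives B' divisible by h do not disturb ψ, by N
h-periodicity, nor the exponential, by 24 ∣ N h s. -/
theorem heckeTerm_transf {ψ : ℤ → ℂ} {h : ℕ} {s : ℤ} {p : ℕ} [Fact p.Prime]
    (hF : IsForm N (2 * k) μ F A) (hψ : IsChar N (N * h) ψ) (hhp : Nat.Coprime h p)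
    (hpN : ¬ p ∣ N) (hs : (24 : ℤ) ∣ N * h * s) (hps : (24 : ℤ) ∣ (p ^ 2 - 1) * s)
    (hμ : ∀ c d : ℤ, 0 < c → 0 < d → IsCoprime d (N * c) → μ c d = ψ d * e24 (-(d * c * s)))
    {a b c d : ℤ} (hc : 0 < c) (hd : 0 < d) (hdet : a * d - b * (N * c) = 1) {z : ℂ}
    (hz : 0 < z.im) (o : Option (ZMod p)) :
    ∃ o' : Option (ZMod p),
      (match o, o' with
        | none, none => ((N * c : ℤ) : ZMod p) = 0
        | none, some y => ((N * c : ℤ) : ZMod p) * y = d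
        | some x, none => a + x * ((N * c : ℤ) : ZMod p) = 0
        | some x, some y => (a + x * ((N * c : ℤ) : ZMod p)) * y = b + x * d) ∧
      heckeTerm k p (ψ p) F ((a * z + b) / (N * c * z + d)) o =
        ψ d * e24 (-(d * c * (p * s))) * (N * c * z + d) ^ k * heckeTerm k p (ψ p) F z o' := by
  have hp : p.Prime := Fact.out
  have hp0 : (p : ℂ) ≠ 0 := by exact_mod_cast hp.ne_zero
  have hpz : (0 : ℤ) < p := by exact_mod_cast hp.pos
  have hcop : IsCoprime d ((N : ℤ) * c) := ⟨a, -b, by linear_combination hdet⟩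
  have hdN : IsCoprime d (N : ℤ) := hcop.of_mul_right_left
  have hpN' : IsCoprime (p : ℤ) (N : ℤ) := by
    rw [Nat.isCoprime_iff_coprime]; exact (Nat.Prime.coprime_iff_not_dvd hp).2 hpN
  have hden : (N * c * z + d : ℂ) ≠ 0 := by
    have := int_den_ne_zero (a := a) (b := b) (c := N * c) (d := d) (by rw [hdet]; simp) hz
    exact_mod_cast this
  have him : 0 < ((p : ℂ) * z).im := by simpa using mul_pos (Nat.cast_pos.2 hp.pos) hz
  have hNc : (0 : ℤ) ≤ N * c := by positivity
  rcases o with _ | x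
  · by_cases hpc : (p : ℤ) ∣ c
    · refine ⟨none, ?_, ?_⟩
      · rw [ZMod.intCast_zmod_eq_zero_iff_dvd]
        exact hpc.mul_left _
      · obtain ⟨e, rfl⟩ := hpc
        have he : 0 < e := pos_of_mul_pos_right hc hpz.le
        have h1 := hF.transf a (p * b) e d he hd (by linear_combination hdet) (p * z) him
        rw [hμ e d he hd (by
          refine ⟨a, -(p * b), by linear_combination hdet⟩), cpow_half_zpow] at h1
        -- Here p² s ≡ s modulo 24 is used.
        have h2 : e24 (-(d * e * s)) = e24 (-(d * (p * e) * (p * s))) := by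
          apply e24_congr
          obtain ⟨t, ht⟩ := hps
          exact ⟨d * e * t, by linear_combination d * e * ht⟩
        simp only [heckeTerm]
        rw [h2] at h1
        have e1 : (N * e * (p * z) + d : ℂ) = N * (p * e : ℤ) * z + d := by push_cast; ring
        have e2 : (a * (p * z) + (p * b : ℤ) : ℂ) = p * (a * z + b) := by push_cast; ring
        rw [e1, e2] at h1
        rw [← mul_div_assoc, h1]
        ring
    · have hpNc : IsCoprime ((N : ℤ) * c) p := by
        refine IsCoprime.mul_left hpN'.symm ?_
        exact ((Nat.prime_iff_prime_int.1 hp).irreducible.coprime_iff_not_dvd.2 hpc).symm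
      obtain ⟨u, hu⟩ := intCast_isUnit hpNc
      obtain ⟨B', hB1, hB2, hB3⟩ := exists_nonpos_lift hhp (↑u⁻¹ * d : ZMod p)
      have hrel : ((N * c : ℤ) : ZMod p) * B' = d := by
        rw [← hu, hB1, ← mul_assoc, Units.mul_inv, one_mul]
      refine ⟨some (B' : ZMod p), hrel, ?_⟩
      obtain ⟨e, he⟩ : (p : ℤ) ∣ d - N * c * B' := by
        rw [← ZMod.intCast_eq_intCast_iff_dvd_sub]
        push_cast at hrel ⊢
        exact hrel
      have hpos : 0 < d - N * c * B' := by nlinarith [mul_nonneg hNc (neg_nonneg.2 hB3)]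
      have he0 : 0 < e := pos_of_mul_pos_right (he ▸ hpos) hpz.le
      have hdet' : (p * a) * e - (b - a * B') * (N * c) = 1 := by
        linear_combination hdet - a * he
      have hecop : IsCoprime e ((N : ℤ) * c) := ⟨p * a, -(b - a * B'), by linear_combination hdet'⟩
      have h1 := hF.transf (p * a) (b - a * B') c e hc he0 hdet' _ (im_add_div_pos hz B' hp.pos)
      rw [hμ c e hc he0 hecop, cpow_half_zpow] at h1
      have h5 := hF.add_div_congr hz hp.pos (B := B') (B' := ((B' : ZMod p).val : ℤ)) (by simp)
      -- p e = d - N c B' is congruent to d modulo N h, because h divides B'.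
      have h6 : ψ p * ψ e = ψ d := by
        rw [← hψ.mul p e hpz he0 hpN' hecop.of_mul_right_left, ← he]
        refine hψ.periodic _ _ hpos hd ?_ ?_
        · rw [he]; exact hpN'.mul_left hecop.of_mul_right_left
        · obtain ⟨t, rfl⟩ := hB2
          exact ⟨-(c * t), by push_cast; ring⟩
      have h7 : e24 (-(e * c * s)) = e24 (-(d * c * (p * s))) := by
        apply e24_congr
        obtain ⟨t, ht⟩ := hps
        obtain ⟨t', ht'⟩ := hs
        obtain ⟨t'', rfl⟩ := hB2
        refine ⟨e * c * t + c * p * c * t'' * t', ?_⟩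
        linear_combination e * c * ht + c * p * c * t'' * ht' + c * s * p * he
      have heC : (d - N * c * B' : ℂ) = p * e := by exact_mod_cast he
      have e1 : (N * c * ((z + B') / p) + e : ℂ) = (N * c * z + d) / p := by
        field_simp
        linear_combination -heC
      have e2 : ((p * a : ℤ) * ((z + B') / p) + (b - a * B' : ℤ) : ℂ) = a * z + b := by
        push_cast; field_simp; ring
      rw [e1, e2, h7, h5] at h1
      simp only [heckeTerm]
      have e3 : (p : ℂ) * ((a * z + b) / (N * c * z + d)) =
          (a * z + b) / ((N * c * z + d) / p) := by
        generalize (a * z + b : ℂ) = X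
        generalize (N * c * z + d : ℂ) = Y at hden
        field_simp
      rw [e3, h1, ← h6, div_zpow]
      have hpk : (p : ℂ) ^ k ≠ 0 := zpow_ne_zero _ hp0
      push_cast
      field_simp
  · by_cases hpx : (a : ZMod p) + x * ((N * c : ℤ) : ZMod p) = 0
    · refine ⟨none, hpx, ?_⟩
      obtain ⟨e, he⟩ : (p : ℤ) ∣ a + x.val * (N * c) := by
        rw [← ZMod.intCast_zmod_eq_zero_iff_dvd]
        push_cast at hpx ⊢
        rwa [ZMod.natCast_zmod_val]
      have hdet' : e * (p * d) - (b + x.val * d) * (N * c) = 1 := by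
        linear_combination hdet - d * he
      have h1 := hF.transf e (b + x.val * d) c (p * d) hc (by positivity) hdet' _ him
      rw [hμ c _ hc (by positivity) ⟨e, -(b + x.val * d), by linear_combination hdet'⟩,
        hψ.mul p d hpz hd hpN' hdN, cpow_half_zpow] at h1
      have heC : (a + x.val * (N * c) : ℂ) = p * e := by exact_mod_cast he
      have e1 : (N * c * (p * z) + (p * d : ℤ) : ℂ) = p * (N * c * z + d) := by push_cast; ring
      have e2 : (e * (p * z) + (b + x.val * d : ℤ) : ℂ) =
          (a * z + b) + x.val * (N * c * z + d) := by
        push_cast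
        linear_combination -z * heC
      rw [e1, e2, mul_zpow] at h1
      simp only [heckeTerm]
      have e3 : ((a * z + b) / (N * c * z + d) + x.val : ℂ) / p =
          ((a * z + b) + x.val * (N * c * z + d)) / (p * (N * c * z + d)) := by
        generalize (a * z + b : ℂ) = X
        generalize (N * c * z + d : ℂ) = Y at hden
        field_simp
      rw [e3, h1, show -(p * d * c * s) = -(d * c * (p * s)) by ring]
      ring
    · obtain ⟨u, hu⟩ := isUnit_iff_ne_zero.2 hpx
      obtain ⟨B', hB1, hB2, hB3⟩ := exists_nonpos_lift hhp (↑u⁻¹ * (b + x * d) : ZMod p)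
      have hrel : (a + x * ((N * c : ℤ) : ZMod p)) * (B' : ZMod p) = b + x * d := by
        rw [← hu, hB1, ← mul_assoc, Units.mul_inv, one_mul]
      refine ⟨some (B' : ZMod p), hrel, ?_⟩
      have h4 := hF.transf_add_div hp.pos (B := x.val) hc hd hdet hB3 (by
        rw [← ZMod.intCast_eq_intCast_iff]
        push_cast at hrel ⊢
        rw [ZMod.natCast_zmod_val, hrel, sub_self]) hz
      have hpos : 0 < d - N * c * B' := by nlinarith [mul_nonneg hNc (neg_nonneg.2 hB3)]
      have hcop' : IsCoprime (d - N * c * B') ((N : ℤ) * c) := by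
        obtain ⟨u, v, huv⟩ := hcop
        exact ⟨u, v + u * B', by linear_combination huv⟩
      have hcop2 : IsCoprime (d - N * c * B') (N * (p * c) : ℤ) := by
        have hx' : IsCoprime (d - N * c * B') (p : ℤ) := by
          obtain ⟨e, he⟩ : (p : ℤ) ∣ (a + x.val * (N * c)) * B' - (b + x.val * d) := by
            rw [← ZMod.intCast_zmod_eq_zero_iff_dvd]
            push_cast at hrel ⊢
            rw [ZMod.natCast_zmod_val, hrel, sub_self]
          exact ⟨a + x.val * (N * c), N * c * e, by linear_combination hdet - N * c * he⟩
        rw [show (N * (p * c) : ℤ) = p * (N * c) by ring]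
        exact hx'.mul_right hcop'
      rw [hμ (p * c) _ (by positivity) hpos hcop2, cpow_half_zpow,
        hψ.periodic _ d hpos hd hcop'.of_mul_right_left (by
          obtain ⟨t, rfl⟩ := hB2
          exact ⟨-(c * t), by push_cast; ring⟩)] at h4
      have h7 : e24 (-((d - N * c * B') * (p * c) * s)) = e24 (-(d * c * (p * s))) := by
        apply e24_congr
        obtain ⟨t', ht'⟩ := hs
        obtain ⟨t'', rfl⟩ := hB2
        exact ⟨c * p * c * t'' * t', by linear_combination c * p * c * t'' * ht'⟩
      have h5 := hF.add_div_congr hz hp.pos (B := B') (B' := ((B' : ZMod p).val : ℤ)) (by simp)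
      rw [h7, h5] at h4
      simp only [heckeTerm]
      exact_mod_cast h4

theorem hecke_isForm {ψ : ℤ → ℂ} {h : ℕ} {s : ℤ} {p : ℕ} [Fact p.Prime]
    (hF : IsForm N (2 * k) μ F A) (hψ : IsChar N (N * h) ψ) (hhp : Nat.Coprime h p)
    (hpN : ¬ p ∣ N) (hs : (24 : ℤ) ∣ N * h * s) (hps : (24 : ℤ) ∣ (p ^ 2 - 1) * s)
    (hμ : ∀ c d : ℤ, 0 < c → 0 < d → IsCoprime d (N * c) → μ c d = ψ d * e24 (-(d * c * s))) :
    IsForm N (2 * k) (fun c d => ψ d * e24 (-(d * c * (p * s)))) (hecke k p (ψ p) F)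
      (fun n => A (p * n) + ψ p * (p : ℂ) ^ (k - 1) * if p ∣ n then A (n / p) else 0) where
  diff := by
    have hp : p.Prime := Fact.out
    refine (hF.differentiableOn_average p).add ?_
    refine (differentiableOn_comp_affine hF.diff (by fun_prop) fun z hz => ?_).const_mul _
    simpa using mul_pos (Nat.cast_pos.2 hp.pos) hz
  bdd := by
    have hp : p.Prime := Fact.out
    refine (hF.boundedAtCusps_average p).add (BoundedAtCusps.const_mul ?_ _)
    have := hF.bdd.comp (A := p) (D := 1) 0 (by exact_mod_cast hp.pos) one_pos
    simpa using this
  hasSum z hz := by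
    have hp : p.Prime := Fact.out
    have := (hasSum_average hF.hasSum p hz).add
      ((hasSum_comp_mul hF.hasSum hp.pos hz).mul_left (ψ p * (p : ℂ) ^ (k - 1)))
    convert this using 2 with n
    · ring
    · rfl
  transf a b c d hc hd hdet z hz := by
    have hdetp : (a * d - b * ((N * c : ℤ) : ZMod p) : ZMod p) = 1 := by
      exact_mod_cast congrArg (Int.cast : ℤ → ZMod p) hdet
    have key := fun o => heckeTerm_transf hF hψ hhp hpN hs hps hμ hc hd hdet hz o
    choose σ hσ1 hσ2 using key
    generalize ((N * c : ℤ) : ZMod p) = C at hσ1 hdetp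
    -- By `hσ1`, σ is the action of a matrix of determinant one on the projective line over `ZMod
    -- p`: mixed cases contradict the determinant, the others determine the point.
    have hinj : Function.Injective σ := by
      intro x y hxy
      have h1 := hσ1 x
      have h2 := hσ1 y
      rw [hxy] at h1
      generalize σ y = v at h1 h2
      rcases x with _ | x <;> rcases y with _ | y <;> rcases v with _ | v <;> simp only at h1 h2
      · rfl
      · rfl
      · exfalso
        rw [h1] at h2 hdetp
        simp only [mul_zero, add_zero] at h2
        simp [h2] at hdetp
      · exfalso
        have h3 : (0 : ZMod p) = 1 := by linear_combination hdetp + a * h1 - C * h2 + C * y * h1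
        exact zero_ne_one h3
      · exfalso
        rw [h2] at h1 hdetp
        simp only [mul_zero, add_zero] at h1
        simp [h1] at hdetp
      · exfalso
        have h3 : (0 : ZMod p) = 1 := by linear_combination hdetp + a * h2 - C * h1 + C * x * h2
        exact zero_ne_one h3
      · congr 1
        have hC : C ≠ 0 := by
          rintro rfl
          simp only [mul_zero, add_zero] at h1
          simp [h1] at hdetp
        have h3 : (x - y) * C = 0 := by linear_combination h1 - h2
        rcases mul_eq_zero.1 h3 with h4 | h4
        · exact sub_eq_zero.1 h4
        · exact absurd h4 hC
      · congr 1
        have h3 : (d - C * v) * (a + x * C) = (1 : ZMod p) := by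
          linear_combination hdetp - C * h1
        have h4 : (x - y) * (d - C * v) = 0 := by linear_combination h2 - h1
        have h5 : x - y = 0 := by
          linear_combination (a + x * C) * h4 - (x - y) * h3
        exact sub_eq_zero.1 h5
    rw [hecke_eq_sum, hecke_eq_sum, cpow_half_zpow]
    simp only [hσ2]
    rw [← Finset.mul_sum, (Finite.injective_iff_bijective.1 hinj).sum_comp
      (fun o => heckeTerm k p (ψ p) F z o)]
    ring

end IsForm

end EtaQuotient

end

noncomputable section

namespace EtaQuotient

/-! ### Arithmetic of the exponents -/

theorem jacobiSym_prod_left {ι : Type*} (s : Finset ι) (g : ι → ℤ) (b : ℕ) :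
    jacobiSym (∏ i ∈ s, g i) b = ∏ i ∈ s, jacobiSym (g i) b := by
  classical
  induction s using Finset.induction_on with
  | empty => simp
  | insert i s hi ih => rw [Finset.prod_insert hi, Finset.prod_insert hi, jacobiSym.mul_left, ih]

theorem jacobiSym_prod_right {ι : Type*} (s : Finset ι) (g : ι → ℕ) (a : ℤ)
    (hg : ∀ i ∈ s, g i ≠ 0) : jacobiSym a (∏ i ∈ s, g i) = ∏ i ∈ s, jacobiSym a (g i) := by
  classical
  induction s using Finset.induction_on with
  | empty => simp
  | insert i s hi ih =>
    rw [Finset.prod_insert hi, Finset.prod_insert hi,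
      jacobiSym.mul_right' _ (hg i (by simp)) (Finset.prod_ne_zero_iff.2 fun j hj => hg j (by simp [hj])),
      ih fun j hj => hg j (by simp [hj])]

variable {N : ℕ} {r : ℕ → ℤ}

theorem div_ne_zero_of_mem (hN : N ≠ 0) {n : ℕ} (hn : n ∈ N.divisors) : N / n ≠ 0 :=
  (Nat.div_pos (Nat.le_of_dvd (Nat.pos_of_ne_zero hN) (Nat.dvd_of_mem_divisors hn))
    (Nat.pos_of_mem_divisors hn)).ne'

theorem mul_div_of_mem {n : ℕ} (hn : n ∈ N.divisors) : (n : ℤ) * ((N / n : ℕ) : ℤ) = N := by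
  exact_mod_cast Nat.mul_div_cancel' (Nat.dvd_of_mem_divisors hn)

theorem bigPi_ne_zero (hN : N ≠ 0) : bigPi N r ≠ 0 :=
  Finset.prod_ne_zero_iff.2 fun _ hn => pow_ne_zero _ (div_ne_zero_of_mem hN hn)

theorem jacobiSym_bigPi_left (d : ℕ) : jacobiSym (bigPi N r) d =
    ∏ n ∈ N.divisors, jacobiSym ((N / n : ℕ) : ℤ) d ^ (r n).natAbs := by
  rw [bigPi, Nat.cast_prod, jacobiSym_prod_left]
  exact Finset.prod_congr rfl fun n _ => by rw [Nat.cast_pow, jacobiSym.pow_left]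

theorem jacobiSym_bigPi_right (hN : N ≠ 0) (a : ℤ) : jacobiSym a (bigPi N r) =
    ∏ n ∈ N.divisors, jacobiSym a (N / n) ^ (r n).natAbs := by
  rw [bigPi, jacobiSym_prod_right _ _ _ fun n hn => pow_ne_zero _ (div_ne_zero_of_mem hN hn)]
  exact Finset.prod_congr rfl fun n _ => by rw [jacobiSym.pow_right]

/-- If `n² ≡ 1` modulo `q` for all `n ∣ N`, then `∑ (N / n) r_n` vanishes modulo `q`
together with `∑ n r_n`. -/
theorem dvd_xZero (hx : xInf N r = 0) {q : ℤ} (hq : ∀ n ∈ N.divisors, q ∣ (n : ℤ) ^ 2 - 1) :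
    q ∣ xZero N r := by
  have h : xZero N r = xZero N r - N * xInf N r := by rw [hx]; ring
  rw [h, xZero, xInf, Finset.mul_sum, ← Finset.sum_sub_distrib]
  refine Finset.dvd_sum fun n hn => ?_
  obtain ⟨t, ht⟩ := hq n hn
  refine ⟨-(((N / n : ℕ) : ℤ) * r n * t), ?_⟩
  linear_combination -((N / n : ℕ) : ℤ) * r n * ht + n * r n * mul_div_of_mem hn

theorem eight_dvd_xZero (hx : xInf N r = 0) (hN : Odd N) : (8 : ℤ) ∣ xZero N r :=
  dvd_xZero hx fun n hn => Int.eight_dvd_sq_sub_one_of_odd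
    (by exact_mod_cast hN.of_dvd_nat (Nat.dvd_of_mem_divisors hn))

theorem three_dvd_sq_sub_one {n : ℤ} (hn : ¬ (3 : ℤ) ∣ n) : (3 : ℤ) ∣ n ^ 2 - 1 := by
  have h1 : n % 3 = 1 ∨ n % 3 = 2 := by omega
  have h2 := Int.emod_add_mul_ediv n 3
  rcases h1 with h | h
  · rw [h] at h2
    exact ⟨n / 3 * (n + 1), by linear_combination -(n + 1) * h2⟩
  · rw [h] at h2
    exact ⟨(n / 3 + 1) * (n - 1), by linear_combination -(n - 1) * h2⟩

theorem three_dvd_xZero (hx : xInf N r = 0) (hN : ¬ 3 ∣ N) : (3 : ℤ) ∣ xZero N r :=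
  dvd_xZero hx fun n hn => three_dvd_sq_sub_one fun h =>
    hN ((by exact_mod_cast h : 3 ∣ n).trans (Nat.dvd_of_mem_divisors hn))

/-- The auxiliary modulus: `8` for even level and `1` for odd level. -/
def auxModulus (N : ℕ) : ℕ := if Even N then 8 else 1

/-- A factor 8 or 3 not supplied by N times the auxiliary modulus is supplied by `xZero`, since then
all n ∣ N satisfy n² ≡ 1. Hence moving d by a multiple of N · `auxModulus N` leaves the exponential
part of the multiplier unchanged. -/
theorem dvd_mul_xZero (hx : xInf N r = 0) : (24 : ℤ) ∣ N * auxModulus N * xZero N r := by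
  have h8 : (8 : ℤ) ∣ N * auxModulus N * xZero N r := by
    rcases Nat.even_or_odd N with h | h
    · rw [auxModulus, if_pos h]
      exact ⟨N * xZero N r, by push_cast; ring⟩
    · exact (eight_dvd_xZero hx h).mul_left _
  have h3 : (3 : ℤ) ∣ N * auxModulus N * xZero N r := by
    by_cases h : 3 ∣ N
    · rw [mul_assoc]
      exact Dvd.dvd.mul_right (by exact_mod_cast h) _
    · exact (three_dvd_xZero hx h).mul_left _
  omega

/-- All N / n are odd, so `twoK` has the parity of `xZero`, which is divisible by 8. Thus
half-integral weight forces an even level. -/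
theorem even_twoK (hx : xInf N r = 0) (hN : Odd N) : Even (twoK N r) := by
  have h1 : (2 : ℤ) ∣ xZero N r - twoK N r := by
    rw [xZero, twoK, ← Finset.sum_sub_distrib]
    refine Finset.dvd_sum fun n hn => ?_
    have h2 : Odd (N / n) := hN.of_dvd_nat (Nat.div_dvd_of_dvd (Nat.dvd_of_mem_divisors hn))
    obtain ⟨t, ht⟩ := h2
    exact ⟨t * r n, by rw [ht]; push_cast; ring⟩
  have h2 := eight_dvd_xZero hx hN
  rw [even_iff_two_dvd]
  omega

theorem χ₄_eq_e24 {m : ℕ} (hm : Odd m) : ((ZMod.χ₄ m : ℤ) : ℂ) = e24 (6 * (m - 1)) := by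
  obtain ⟨t, rfl⟩ := hm
  rw [ZMod.χ₄_eq_neg_one_pow (by omega), show (6 * (((2 * t + 1 : ℕ) : ℤ) - 1)) = 12 * t by
    push_cast; ring, e24_twelve_mul, show (2 * t + 1) / 2 = t by omega]
  push_cast
  rfl

theorem zpow_eq_pow_natAbs {x : ℂ} (hx : x = 1 ∨ x = -1) (n : ℤ) : x ^ n = x ^ n.natAbs := by
  rcases Int.natAbs_eq n with h | h <;> rcases hx with rfl | rfl <;> conv_lhs => rw [h]
  · simp
  · rw [zpow_natCast]
  · simp
  · rw [zpow_neg, zpow_natCast, ← inv_pow]; norm_num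

theorem odd_bigPi (hN : Odd N) : Odd (bigPi N r) :=
  Finset.prod_induction _ Odd (fun _ _ => Odd.mul) odd_one fun _ hn =>
    (hN.of_dvd_nat (Nat.div_dvd_of_dvd (Nat.dvd_of_mem_divisors hn))).pow

/-- The signs of the χ₄(N / n) add up to the exponent 6 (`xZero` - `twoK`); `xZero` drops out
because 8 divides it, and the sign of `twoK` is immaterial because it is even. -/
theorem χ₄_bigPi (hx : xInf N r = 0) (hN : Odd N) :
    ((ZMod.χ₄ (bigPi N r : ℕ) : ℤ) : ℂ) = e24 (6 * twoK N r) := by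
  have h1 : ∀ n ∈ N.divisors, ((ZMod.χ₄ ((N / n : ℕ) : ZMod 4) : ℤ) : ℂ) ^ (r n).natAbs =
      e24 (6 * ((N / n : ℕ) - 1) * r n) := by
    intro n hn
    have hodd : Odd (N / n) := hN.of_dvd_nat (Nat.div_dvd_of_dvd (Nat.dvd_of_mem_divisors hn))
    rw [← zpow_eq_pow_natAbs, χ₄_eq_e24 hodd, e24_zpow]
    rw [ZMod.χ₄_eq_neg_one_pow (Nat.odd_iff.1 hodd)]
    rcases neg_one_pow_eq_or ℤ (N / n / 2) with h | h <;> simp [h]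
  rw [bigPi]
  push_cast
  rw [map_prod]
  push_cast
  simp only [map_pow, Int.cast_pow]
  rw [Finset.prod_congr rfl h1, e24_prod]
  apply e24_congr
  have h2 : ∑ n ∈ N.divisors, 6 * (((N / n : ℕ) : ℤ) - 1) * r n = 6 * (xZero N r - twoK N r) := by
    rw [xZero, twoK, ← Finset.sum_sub_distrib, Finset.mul_sum]
    exact Finset.sum_congr rfl fun n _ => by ring
  rw [h2]
  have := eight_dvd_xZero hx hN
  obtain ⟨t, ht⟩ := even_twoK hx hN
  omega

/-- The Nebentypus part of the multiplier of an eta-quotient. -/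
def nebentypus (N : ℕ) (r : ℕ → ℤ) (d : ℤ) : ℂ :=
  if Even N then jacobiSym (bigPi N r) d.natAbs * e24 (3 * twoK N r * (d - 1))
  else jacobiSym d (bigPi N r)

/-- At odd level this is reciprocity between d and Π, with χ₄(Π) known from `χ₄_bigPi`. The form (d
/ Π) also makes sense for even d, which can occur only at odd level. -/
theorem nebentypus_of_odd (hx : xInf N r = 0) {d : ℕ} (hd : Odd d) :
    nebentypus N r d = jacobiSym (bigPi N r) d * e24 (3 * twoK N r * (d - 1)) := by
  rw [nebentypus]
  split_ifs with h
  · simp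
  · rw [Nat.not_even_iff_odd] at h
    have h2 : e24 (3 * twoK N r * (d - 1)) = (-1) ^ (bigPi N r / 2 * (d / 2)) := by
      obtain ⟨t, ht⟩ := hd
      have h3 : 3 * twoK N r * (d - 1) = 6 * twoK N r * (d / 2 : ℕ) := by
        rw [ht, show (2 * t + 1) / 2 = t by omega]; push_cast; ring
      rw [h3, ← e24_zpow, ← χ₄_bigPi hx h, zpow_natCast,
        ZMod.χ₄_eq_neg_one_pow (Nat.odd_iff.1 (odd_bigPi h)), pow_mul]
      push_cast
      rfl
    rw [h2, jacobiSym.quadratic_reciprocity (odd_bigPi h) hd]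
    push_cast
    rw [mul_comm, ← mul_assoc, ← mul_pow]
    simp

theorem odd_of_isCoprime {d : ℤ} (hN : Even N) (h : IsCoprime d (N : ℤ)) : Odd d := by
  rw [← Int.not_even_iff_odd]
  intro hd
  obtain ⟨a, ha⟩ := hd
  obtain ⟨b, hb⟩ := hN
  obtain ⟨u, v, huv⟩ := h
  rw [ha, hb] at huv
  push_cast at huv
  have : (2 : ℤ) * (u * a + v * b) = 1 := by linear_combination huv
  omega

theorem nebentypus_one : nebentypus N r 1 = 1 := by
  rw [nebentypus]
  split_ifs <;> simp [e24_zero]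

/-- At even level (N/n over d) depends on d modulo 4 N / n, a divisor of 8 N, and the exponential on
d modulo 8. At odd level (d over N/n) depends on d modulo N / n. -/
theorem nebentypus_periodic (hN : N ≠ 0) (a b : ℤ) (ha : 0 < a) (hb : 0 < b)
    (hcop : IsCoprime a (N : ℤ)) (h : ((N * auxModulus N : ℕ) : ℤ) ∣ a - b) :
    nebentypus N r a = nebentypus N r b := by
  rw [nebentypus, nebentypus]
  split_ifs with hev
  · rw [auxModulus, if_pos hev] at h
    have hao := odd_of_isCoprime hev hcop
    have hbo : Odd b := by
      have h2 : (2 : ℤ) ∣ a - b := dvd_trans ⟨N * 4, by push_cast; ring⟩ h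
      obtain ⟨t, ht⟩ := hao
      exact Int.odd_iff.2 (by omega)
    lift a to ℕ using ha.le
    lift b to ℕ using hb.le
    have hao' : Odd a := by exact_mod_cast hao
    have hbo' : Odd b := by exact_mod_cast hbo
    simp only [Int.natAbs_natCast]
    congr 1
    · rw [jacobiSym_bigPi_left, jacobiSym_bigPi_left]
      congr 1
      refine Finset.prod_congr rfl fun n hn => ?_
      rw [jacobiSym.mod_right' _ hao', jacobiSym.mod_right' _ hbo']
      have h3 : (4 * (N / n)) ∣ N * 8 := by
        obtain ⟨t, ht⟩ := Nat.div_dvd_of_dvd (Nat.dvd_of_mem_divisors hn)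
        exact ⟨t * 2, by nth_rewrite 1 [ht]; ring⟩
      have h4 : a ≡ b [MOD 4 * (N / n)] := by
        rw [← Int.natCast_modEq_iff]
        exact (Int.modEq_iff_dvd.2 (dvd_trans (by exact_mod_cast h3) h)).symm
      rw [h4]
    · apply e24_congr
      obtain ⟨t, ht⟩ := h
      push_cast at ht
      exact ⟨twoK N r * N * t, by linear_combination 3 * twoK N r * ht⟩
  · rw [auxModulus, if_neg hev] at h
    rw [jacobiSym_bigPi_right hN, jacobiSym_bigPi_right hN]
    congr 1
    refine Finset.prod_congr rfl fun n hn => ?_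
    rw [jacobiSym.mod_left' (a₁ := a) (a₂ := b)]
    refine (Int.modEq_iff_dvd.2 ?_).symm
    refine dvd_trans ?_ h
    rw [mul_one]
    exact_mod_cast Nat.div_dvd_of_dvd (Nat.dvd_of_mem_divisors hn)

theorem nebentypus_mul (hw : Even (twoK N r)) (a b : ℤ) (ha : 0 < a) (hb : 0 < b)
    (hca : IsCoprime a (N : ℤ)) (hcb : IsCoprime b (N : ℤ)) :
    nebentypus N r (a * b) = nebentypus N r a * nebentypus N r b := by
  rw [nebentypus, nebentypus, nebentypus]
  split_ifs with hev
  · obtain ⟨s, hs⟩ := odd_of_isCoprime hev hca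
    obtain ⟨t, ht⟩ := odd_of_isCoprime hev hcb
    obtain ⟨k, hk⟩ := hw
    rw [Int.natAbs_mul, jacobiSym.mul_right' _ (by omega) (by omega)]
    have : e24 (3 * twoK N r * (a * b - 1)) =
        e24 (3 * twoK N r * (a - 1)) * e24 (3 * twoK N r * (b - 1)) := by
      rw [← e24_add]
      apply e24_congr
      exact ⟨k * s * t, by rw [hs, ht, hk]; ring⟩
    rw [this]
    push_cast
    ring
  · rw [jacobiSym.mul_left]
    push_cast
    rfl

theorem nebentypus_isChar (hN : N ≠ 0) (hw : Even (twoK N r)) :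
    IsChar N (N * auxModulus N) (nebentypus N r) where
  mul := nebentypus_mul hw
  periodic := nebentypus_periodic hN

/-- The part `(c / d) ^ (2 k)` of the multiplier, which is trivial in integral weight. -/
def thetaPart (w c d : ℤ) : ℂ := if Even w then 1 else jacobiSym c d.natAbs

/-- The multiplier of an eta-quotient with `xInf = 0` on `(a, b; N c, d)`, `c, d > 0`. -/
def mult (N : ℕ) (r : ℕ → ℤ) (s c d : ℤ) : ℂ :=
  thetaPart (twoK N r) c d * nebentypus N r d * e24 (-(d * c * s))

end EtaQuotient

end

/-! ### Transformation of an eta-quotient with `xInf` = 0 under Γ₀(N) -/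

noncomputable section

namespace EtaQuotient

open ModularForm

variable {N : ℕ} {r : ℕ → ℤ}

/-- The eta-quotient as a function of a complex variable. -/
def etaProd (N : ℕ) (r : ℕ → ℤ) (z : ℂ) : ℂ := ∏ n ∈ N.divisors, eta (n * z) ^ r n

theorem im_mul_pos {n : ℕ} (hn : n ∈ N.divisors) {z : ℂ} (hz : 0 < z.im) :
    0 < ((n : ℂ) * z).im := by
  simpa using mul_pos (Nat.cast_pos.2 (Nat.pos_of_mem_divisors hn)) hz

theorem etaProd_ne_zero {z : ℂ} (hz : 0 < z.im) : etaProd N r z ≠ 0 :=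
  Finset.prod_ne_zero_iff.2 fun _ hn => zpow_ne_zero _ (eta_ne_zero (im_mul_pos hn hz))

theorem differentiableOn_etaProd : DifferentiableOn ℂ (etaProd N r) {z | 0 < z.im} := by
  intro z hz
  refine DifferentiableWithinAt.fun_finsetProd fun n hn => ?_
  have h1 : DifferentiableAt ℂ (fun z : ℂ => eta (n * z)) z :=
    (differentiableAt_eta_of_mem_upperHalfPlaneSet (im_mul_pos hn hz)).comp z (by fun_prop)
  exact (h1.zpow (Or.inl (eta_ne_zero (im_mul_pos hn hz)))).differentiableWithinAt

theorem etaProd_add_one (hx : xInf N r = 0) (z : ℂ) : etaProd N r (z + 1) = etaProd N r z := by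
  have h1 : ∀ n ∈ N.divisors, eta (n * (z + 1)) ^ r n = e24 (n * r n) * eta (n * z) ^ r n := by
    intro n _
    have := eta_add_int (n * z) n
    push_cast at this
    rw [mul_add, mul_one, this, mul_zpow, e24_zpow]
  rw [etaProd, Finset.prod_congr rfl h1, Finset.prod_mul_distrib, e24_prod]
  have : ∑ n ∈ N.divisors, (n : ℤ) * r n = 0 := hx
  rw [this, e24_zero, one_mul, etaProd]

theorem prod_zpow_sum {ι : Type*} (s : Finset ι) (g : ι → ℤ) {x : ℂ} (hx : x ≠ 0) :
    ∏ i ∈ s, x ^ g i = x ^ ∑ i ∈ s, g i := by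
  classical
  induction s using Finset.induction_on with
  | empty => simp
  | insert i s hi ih => rw [Finset.prod_insert hi, Finset.sum_insert hi, zpow_add₀ hx, ih]

theorem jacobiSym_cast_eq {a : ℤ} {d : ℕ} (h : IsCoprime a d) :
    (jacobiSym a d : ℂ) = 1 ∨ (jacobiSym a d : ℂ) = -1 := by
  have h1 : a.gcd d = 1 := Int.isCoprime_iff_gcd_eq_one.1 h
  rcases jacobiSym.eq_one_or_neg_one h1 with h2 | h2 <;> simp [h2]

theorem zpow_of_sq_eq_one {x : ℂ} (hx : x = 1 ∨ x = -1) (w : ℤ) :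
    x ^ w = if Even w then 1 else x := by
  split_ifs with h
  · obtain ⟨k, rfl⟩ := h
    rcases hx with rfl | rfl
    · simp
    · rw [zpow_add₀ (by norm_num), ← mul_zpow]; norm_num
  · rw [Int.not_even_iff_odd] at h
    obtain ⟨k, rfl⟩ := h
    rcases hx with rfl | rfl
    · simp
    · rw [zpow_add₀ (by norm_num), zpow_mul]; norm_num

/-- Besides the weight term, only a multiple of `xZero` survives once `xInf` = 0. By the determinant
its coefficient is a c (1 - d²) - d c, and the first summand contributes a multiple of 24. -/
theorem dvd_sum_etaExp (hx : xInf N r = 0) {a b c : ℤ} {d : ℕ} (hd : Odd d)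
    (hdet : a * d - b * (N * c) = 1) :
    (24 : ℤ) ∣ ∑ n ∈ N.divisors, etaExp a (b * n) (c * (N / n : ℕ)) d * r n -
      (3 * twoK N r * (d - 1) + -(d * c * xZero N r)) := by
  have h1 : ∑ n ∈ N.divisors, etaExp a (b * n) (c * (N / n : ℕ)) d * r n =
      ((a + d) * c - 3 * c * d - b * d * c ^ 2 * N) * xZero N r + b * d * xInf N r +
        3 * (d - 1) * twoK N r := by
    rw [xZero, xInf, twoK, Finset.mul_sum, Finset.mul_sum, Finset.mul_sum,
      ← Finset.sum_add_distrib, ← Finset.sum_add_distrib]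
    refine Finset.sum_congr rfl fun n hn => ?_
    simp only [etaExp]
    linear_combination (-b * d * c ^ 2 * (N / n : ℕ) * r n) * mul_div_of_mem hn
  -- 8 comes from d odd; 3 comes from 1 - d² if 3 ∣ N, as then 3 ∤ d, and from `xZero` otherwise.
  have h2 : (24 : ℤ) ∣ (1 - (d : ℤ) ^ 2) * xZero N r := by
    obtain ⟨s, hs⟩ := Int.eight_dvd_sq_sub_one_of_odd (k := d) (by exact_mod_cast hd)
    have h8 : (8 : ℤ) ∣ (1 - (d : ℤ) ^ 2) * xZero N r :=
      ⟨-s * xZero N r, by linear_combination -xZero N r * hs⟩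
    have h3 : (3 : ℤ) ∣ (1 - (d : ℤ) ^ 2) * xZero N r := by
      by_cases h : 3 ∣ N
      · have h4 : ¬ (3 : ℤ) ∣ d := by
          intro h5
          have h6 : (3 : ℤ) ∣ 1 := by
            rw [← hdet]
            have h7 : (3 : ℤ) ∣ N := by exact_mod_cast h
            exact dvd_sub (h5.mul_left _) ((h7.mul_right _).mul_left _)
          norm_num at h6
        obtain ⟨t, ht⟩ := three_dvd_sq_sub_one h4
        exact ⟨-t * xZero N r, by linear_combination -xZero N r * ht⟩
      · exact (three_dvd_xZero hx h).mul_left _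
    omega
  obtain ⟨t, ht⟩ := h2
  rw [h1, hx]
  exact ⟨a * c * t, by linear_combination a * c * ht + d * c * xZero N r * hdet⟩

/-- n γ z is the image of n z under (a, b n; c N / n, d), with the same automorphy factor N c z + d
for every n, so the formulas of `etaTransf` multiply. -/
theorem etaProd_transf_of_odd (hx : xInf N r = 0) {a b c : ℤ} {d : ℕ} (hd : Odd d)
    (hdet : a * d - b * (N * c) = 1) {z : ℂ} (hz : 0 < z.im) :
    etaProd N r ((a * z + b) / (N * c * z + d)) =
      mult N r (xZero N r) c d * ((N * c * z + d) ^ (1 / 2 : ℂ)) ^ twoK N r * etaProd N r z := by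
  have hden : (N * c * z + d : ℂ) ≠ 0 := by
    have := int_den_ne_zero (a := a) (b := b) (c := N * c) (d := d) (by rw [hdet]; simp) hz
    exact_mod_cast this
  have hcop : IsCoprime ((N : ℤ) * c) d := ⟨-b, a, by linear_combination hdet⟩
  have hc : IsCoprime c (d : ℤ) := hcop.of_mul_left_right
  have hm : ∀ n ∈ N.divisors, IsCoprime (((N / n : ℕ) : ℤ)) d := fun n hn =>
    hcop.of_mul_left_left.of_isCoprime_of_dvd_left ⟨n, by rw [mul_comm]; exact (mul_div_of_mem hn).symm⟩
  set R : ℂ := (N * c * z + d) ^ (1 / 2 : ℂ) with hR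
  have hR0 : R ≠ 0 := by
    rw [hR, Ne, Complex.cpow_eq_zero_iff]
    exact fun h => hden h.1
  have h1 : ∀ n ∈ N.divisors, eta (n * ((a * z + b) / (N * c * z + d))) ^ r n =
      (jacobiSym c d : ℂ) ^ r n * (jacobiSym ((N / n : ℕ) : ℤ) d : ℂ) ^ (r n).natAbs *
        e24 (etaExp a (b * n) (c * (N / n : ℕ)) d * r n) * R ^ r n * eta (n * z) ^ r n := by
    intro n hn
    have hmn := mul_div_of_mem hn
    have hmnC : (n : ℂ) * ((N / n : ℕ) : ℂ) = N := by exact_mod_cast hmn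
    have h2 := etaTransf d hd a (b * n) (c * (N / n : ℕ))
      (by linear_combination hdet - b * c * hmn) _ (im_mul_pos hn hz)
    have e1 : ((c * (N / n : ℕ) : ℤ) : ℂ) * (n * z) + d = N * c * z + d := by
      rw [Int.cast_mul, Int.cast_natCast]
      linear_combination c * z * hmnC
    have e2 : (a : ℂ) * (n * z) + (b * n : ℤ) = n * (a * z + b) := by push_cast; ring
    rw [e1, e2, mul_div_assoc] at h2
    rw [h2, jacobiSym.mul_left, mul_zpow, mul_zpow, mul_zpow, e24_zpow,
      ← zpow_eq_pow_natAbs (jacobiSym_cast_eq (hm n hn))]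
    push_cast
    rw [mul_zpow]
  rw [etaProd, Finset.prod_congr rfl h1]
  simp only [Finset.prod_mul_distrib]
  have hJ0 : (jacobiSym c d : ℂ) ≠ 0 := by
    rcases jacobiSym_cast_eq hc with h | h <;> rw [h] <;> norm_num
  rw [prod_zpow_sum _ _ hR0, prod_zpow_sum _ _ hJ0, e24_prod, e24_congr (dvd_sum_etaExp hx hd hdet),
    e24_add, mult, nebentypus_of_odd hx hd, jacobiSym_bigPi_left]
  have h3 : (jacobiSym c d : ℂ) ^ (∑ n ∈ N.divisors, r n) = thetaPart (twoK N r) c d := by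
    rw [zpow_of_sq_eq_one (jacobiSym_cast_eq hc)]
    rfl
  rw [h3]
  push_cast
  rw [etaProd, twoK]
  ring

/-- An even d forces N and c to be odd. Then d + N c is odd, and the 1-periodicity of f reduces the
claim to the odd case at z - 1. -/
theorem mult_transf (hN : N ≠ 0) (hx : xInf N r = 0) {a b c d : ℤ} (hc : 0 < c) (hd : 0 < d)
    (hdet : a * d - b * (N * c) = 1) {z : ℂ} (hz : 0 < z.im) :
    etaProd N r ((a * z + b) / (N * c * z + d)) =
      mult N r (xZero N r) c d * ((N * c * z + d) ^ (1 / 2 : ℂ)) ^ twoK N r * etaProd N r z := by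
  have hcop : IsCoprime d ((N : ℤ) * c) := ⟨a, -b, by linear_combination hdet⟩
  rcases Int.even_or_odd d with hev | hodd
  · have hNc : Odd ((N : ℤ) * c) := by
      rw [← Int.not_even_iff_odd]
      rintro ⟨s, hs⟩
      obtain ⟨t, ht⟩ := hev
      have : (2 : ℤ) * (a * t - b * s) = 1 := by
        rw [hs, ht] at hdet; linear_combination hdet
      omega
    have hNo : Odd N := by exact_mod_cast (Int.odd_mul.1 hNc).1
    have hN1 : ¬ Even N := Nat.not_even_iff_odd.2 hNo
    lift d to ℕ using hd.le
    lift c to ℕ using hc.le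
    have hd' : Odd (d + N * c) := by
      have : Odd ((d : ℤ) + N * c) := hev.add_odd hNc
      exact_mod_cast this
    have h1 := etaProd_transf_of_odd (r := r) hx hd' (a := a) (b := b + a) (c := c)
      (by push_cast; linear_combination hdet) (z := z - 1) (by simpa using hz)
    have h2 := etaProd_add_one hx (z - 1)
    rw [sub_add_cancel] at h2
    have e1 : (N * (c : ℤ) * (z - 1) + (d + N * c : ℕ) : ℂ) = N * (c : ℤ) * z + (d : ℤ) := by
      push_cast; ring
    have e2 : (a * (z - 1) + (b + a : ℤ) : ℂ) = a * z + b := by push_cast; ring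
    rw [e1, e2, ← h2] at h1
    rw [h1]
    congr 2
    rw [mult, mult, nebentypus_periodic hN (d + N * c : ℕ) d (by exact_mod_cast hd'.pos) hd]
    · congr 1
      · congr 1
        simp [thetaPart, even_twoK hx hNo]
      · apply e24_congr
        obtain ⟨t, ht⟩ := dvd_mul_xZero hx
        rw [auxModulus, if_neg hN1] at ht
        push_cast at ht ⊢
        exact ⟨-(c * c * t), by linear_combination -(c : ℤ) * c * ht⟩
    · push_cast
      obtain ⟨u, v, huv⟩ := hcop
      exact ⟨u, v * c - u * c, by linear_combination huv⟩
    · rw [auxModulus, if_neg hN1]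
      exact ⟨c, by push_cast; ring⟩
  · lift d to ℕ using hd.le
    exact etaProd_transf_of_odd hx (by exact_mod_cast hodd) (by exact_mod_cast hdet) hz

end EtaQuotient

end

noncomputable section

namespace EtaQuotient

open ModularForm

variable {N : ℕ} {r : ℕ → ℤ}

/-! ### The first Fourier coefficients of an eta-quotient -/

/-- The Euler function `∏ (1 - q ^ m)`. -/
def eulerProd (q : ℂ) : ℂ := ∏' n : ℕ, (1 - q ^ (n + 1))

theorem eulerProd_zero : eulerProd 0 = 1 := by simp [eulerProd]

theorem eulerProd_ne_zero {q : ℂ} (hq : ‖q‖ < 1) : eulerProd q ≠ 0 := by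
  have h : ∀ n : ℕ, 1 - q ^ (n + 1) ≠ 0 := by
    intro n h0
    have h1 : q ^ (n + 1) = 1 := (sub_eq_zero.1 h0).symm
    have h2 : ‖q‖ ^ (n + 1) = 1 := by rw [← norm_pow, h1, norm_one]
    exact absurd h2 (pow_lt_one₀ (norm_nonneg _) hq (by omega)).ne
  have := tprod_one_add_ne_zero_of_summable (f := fun n : ℕ => -q ^ (n + 1))
    (by simpa [sub_eq_add_neg] using h) (by
      simpa [norm_neg, norm_pow] using
        (summable_nat_add_iff 1).mpr (summable_geometric_of_lt_one (norm_nonneg q) hq))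
  simpa [eulerProd, sub_eq_add_neg] using this

theorem differentiableAt_eulerProd {q : ℂ} (hq : ‖q‖ < 1) : DifferentiableAt ℂ eulerProd q :=
  differentiableOn_tprod_one_sub_pow.differentiableAt
    (Metric.isOpen_ball.mem_nhds (by simpa using hq))

/-- Only the factor 1 - q has a nonzero logarithmic derivative at 0. -/
theorem logDeriv_eulerProd_zero : logDeriv eulerProd 0 = -1 := by
  have h0 : ∀ n : ℕ, logDeriv (fun q : ℂ => 1 - q ^ (n + 1)) 0 = if n = 0 then -1 else 0 := by
    intro n
    rw [logDeriv_apply, deriv_const_sub, deriv_pow_field]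
    split_ifs with h
    · simp [h]
    · simp [h]
  have h := logDeriv_tprod_eq_tsum (f := fun (n : ℕ) (q : ℂ) => 1 - q ^ (n + 1))
    Metric.isOpen_ball (x := (0 : ℂ)) (s := Metric.ball 0 1) (by simp) (by simp)
    (fun i => by fun_prop) (by
      simp only [h0]
      exact (hasSum_ite_eq 0 (-1 : ℂ)).summable)
    multipliableLocallyUniformlyOn_one_sub_pow (by simp)
  have h2 : (fun q : ℂ => ∏' n : ℕ, (1 - q ^ (n + 1))) = eulerProd := rfl
  rw [h2] at h
  rw [h]
  simp only [h0]
  exact tsum_ite_eq 0 _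

/-- The power series in `q` of an eta-quotient with `xInf = 0`, as a function on the disc. -/
def discProd (N : ℕ) (r : ℕ → ℤ) (q : ℂ) : ℂ := ∏ n ∈ N.divisors, eulerProd (q ^ n) ^ r n

theorem norm_pow_lt_one_of_mem {n : ℕ} (hn : n ∈ N.divisors) {q : ℂ} (hq : ‖q‖ < 1) :
    ‖q ^ n‖ < 1 := by
  rw [norm_pow]
  exact pow_lt_one₀ (norm_nonneg _) hq (Nat.pos_of_mem_divisors hn).ne'

theorem differentiableAt_discProd_term {n : ℕ} (hn : n ∈ N.divisors) {q : ℂ} (hq : ‖q‖ < 1) :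
    DifferentiableAt ℂ (fun q : ℂ => eulerProd (q ^ n)) q :=
  (differentiableAt_eulerProd (norm_pow_lt_one_of_mem hn hq)).comp q (differentiableAt_pow n)

theorem differentiableOn_discProd : DifferentiableOn ℂ (discProd N r) (Metric.ball 0 1) := by
  intro q hq
  have hq' : ‖q‖ < 1 := by simpa using hq
  refine DifferentiableWithinAt.fun_finsetProd fun n hn => ?_
  exact ((differentiableAt_discProd_term hn hq').zpow
    (Or.inl (eulerProd_ne_zero (norm_pow_lt_one_of_mem hn hq')))).differentiableWithinAt

theorem discProd_zero : discProd N r 0 = 1 := by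
  refine Finset.prod_eq_one fun n hn => ?_
  rw [zero_pow (Nat.pos_of_mem_divisors hn).ne', eulerProd_zero, one_zpow]

theorem deriv_discProd_zero (hN : N ≠ 0) : deriv (discProd N r) 0 = -r 1 := by
  have h1 : logDeriv (discProd N r) 0 = deriv (discProd N r) 0 := by
    rw [logDeriv_apply, discProd_zero, div_one]
  have h0 : ‖(0 : ℂ)‖ < 1 := by simp
  have h2 : logDeriv (discProd N r) 0 =
      ∑ n ∈ N.divisors, logDeriv (fun q : ℂ => eulerProd (q ^ n) ^ r n) 0 := by
    have : discProd N r = fun q => ∏ n ∈ N.divisors, (fun q : ℂ => eulerProd (q ^ n) ^ r n) q := rfl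
    rw [this, logDeriv_prod]
    · intro n hn
      exact zpow_ne_zero _ (eulerProd_ne_zero (norm_pow_lt_one_of_mem hn h0))
    · intro n hn
      exact (differentiableAt_discProd_term hn h0).zpow
        (Or.inl (eulerProd_ne_zero (norm_pow_lt_one_of_mem hn h0)))
  have h3 : ∀ n ∈ N.divisors, logDeriv (fun q : ℂ => eulerProd (q ^ n) ^ r n) 0 =
      if n = 1 then -(r 1 : ℂ) else 0 := by
    intro n hn
    have hn0 := Nat.pos_of_mem_divisors hn
    rw [logDeriv_fun_zpow (differentiableAt_discProd_term hn h0)]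
    have h4 := logDeriv_comp (f := eulerProd) (g := fun q : ℂ => q ^ n) (x := 0)
      (differentiableAt_eulerProd (norm_pow_lt_one_of_mem hn h0)) (by fun_prop)
    have h5 : eulerProd ∘ (fun q : ℂ => q ^ n) = fun q : ℂ => eulerProd (q ^ n) := rfl
    rw [h5] at h4
    rw [h4, zero_pow hn0.ne', logDeriv_eulerProd_zero, deriv_pow_field]
    split_ifs with h
    · simp [h]
    · have : n - 1 ≠ 0 := by omega
      simp [this]
  rw [← h1, h2, Finset.sum_congr rfl h3, Finset.sum_ite_eq' N.divisors 1,
    if_pos (Nat.one_mem_divisors.2 hN)]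

/-- The fractional powers of q multiply to q to the power `xInf` / 24, which is 1. -/
theorem etaProd_eq_discProd (hx : xInf N r = 0) (z : ℂ) :
    etaProd N r z = discProd N r (qExp z) := by
  have h1 : ∀ n ∈ N.divisors, eta (n * z) ^ r n =
      Function.Periodic.qParam 24 z ^ ((n : ℤ) * r n) * eulerProd (qExp z ^ n) ^ r n := by
    intro n _
    have h2 : eta (n * z) = Function.Periodic.qParam 24 z ^ (n : ℤ) * eulerProd (qExp z ^ n) := by
      rw [eta, eulerProd]
      congr 1
      · rw [Function.Periodic.qParam, Function.Periodic.qParam, zpow_natCast, ← Complex.exp_nat_mul]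
        ring_nf
      · refine tprod_congr fun m => ?_
        rw [eta_q_eq_pow, qExp_pow, qExp]
    rw [h2, mul_zpow, zpow_mul]
  rw [etaProd, Finset.prod_congr rfl h1, Finset.prod_mul_distrib,
    prod_zpow_sum _ _ (Function.Periodic.qParam_ne_zero z)]
  have : ∑ n ∈ N.divisors, (n : ℤ) * r n = 0 := hx
  rw [this, zpow_zero, one_mul, discProd]

theorem norm_qExp_lt_one {z : ℂ} (hz : 0 < z.im) : ‖qExp z‖ < 1 := by
  have := UpperHalfPlane.norm_exp_two_pi_I_lt_one ⟨z, hz⟩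
  simpa [qExp] using this

theorem qParam_one (z : ℂ) : Function.Periodic.qParam 1 z = qExp z := by
  simp [Function.Periodic.qParam, qExp]

theorem coe_smul_eq (γ : SL(2, ℤ)) (τ : UpperHalfPlane) :
    ((γ • τ : UpperHalfPlane) : ℂ) =
      ((γ 0 0 : ℂ) * τ + (γ 0 1 : ℂ)) / ((γ 1 0 : ℂ) * τ + (γ 1 1 : ℂ)) := by
  rw [UpperHalfPlane.coe_specialLinearGroup_apply]
  simp

theorem periodic_etaQuotient (hx : xInf N r = 0) :
    Function.Periodic (etaQuotient N r ∘ UpperHalfPlane.ofComplex) (1 : ℝ) := by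
  intro z
  simp only [Function.comp_apply]
  by_cases hz : 0 < z.im
  · have hz1 : 0 < (z + (1 : ℝ)).im := by simpa using hz
    rw [UpperHalfPlane.ofComplex_apply_of_im_pos hz, UpperHalfPlane.ofComplex_apply_of_im_pos hz1]
    have := etaProd_add_one hx z
    simpa [etaProd, etaQuotient] using this
  · have hz1 : (z + (1 : ℝ)).im ≤ 0 := by simpa using hz
    rw [UpperHalfPlane.ofComplex_apply_of_im_nonpos (not_lt.1 hz),
      UpperHalfPlane.ofComplex_apply_of_im_nonpos hz1]

theorem isBoundedAtImInfty_of_mem {w : ℤ} {χ : SL(2, ℤ) → ℤˣ → ℂ} {f : UpperHalfPlane → ℂ}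
    (hf : f ∈ modForms N w χ) : UpperHalfPlane.IsBoundedAtImInfty f := by
  have := hf.2.2 1 1
  have h1 : slash w 1 1 f = f := by
    funext τ
    simp [slash]
  rwa [h1] at this

theorem hasSum_coeff {χ : SL(2, ℤ) → ℤˣ → ℂ} {w : ℤ} (hx : xInf N r = 0)
    (hf : etaQuotient N r ∈ modForms N w χ) {z : ℂ} (hz : 0 < z.im) :
    HasSum (fun n => coeff N r n * qExp z ^ n) (etaProd N r z) := by
  have h := UpperHalfPlane.hasSum_qExpansion (f := etaQuotient N r) (h := 1) one_pos
    (periodic_etaQuotient hx) hf.1 (isBoundedAtImInfty_of_mem hf) ⟨z, hz⟩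
  simp only [qParam_one, smul_eq_mul] at h
  exact h

/-- Two convergent `q`-expansions of the same function have the same coefficients. -/
theorem eq_of_hasSum_qExp {f : UpperHalfPlane → ℂ} {A B : ℕ → ℂ}
    (hf : MDifferentiable (modelWithCornersSelf ℂ ℂ) (modelWithCornersSelf ℂ ℂ) f)
    (hper : Function.Periodic (f ∘ UpperHalfPlane.ofComplex) (1 : ℝ))
    (hA : ∀ τ : UpperHalfPlane, HasSum (fun n => A n * qExp τ ^ n) (f τ))
    (hB : ∀ τ : UpperHalfPlane, HasSum (fun n => B n * qExp τ ^ n) (f τ)) : A = B := by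
  simp only [← qParam_one] at hA hB
  have hbd := UpperHalfPlane.isBoundedAtImInfty_of_hasSum_qExpansion one_pos hA
  have han := UpperHalfPlane.analyticAt_cuspFunction_zero one_pos hper hf hbd
  have h1 := (UpperHalfPlane.hasFPowerSeriesOnBall_cuspFunction one_pos han hA).hasFPowerSeriesAt
  have h2 := (UpperHalfPlane.hasFPowerSeriesOnBall_cuspFunction one_pos han hB).hasFPowerSeriesAt
  funext n
  simpa using congrArg (FormalMultilinearSeries.coeff · n) (h1.eq_formalMultilinearSeries h2)

/-- The Taylor series of `discProd` on the unit disc is another q-expansion of f, and q-expansions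
are unique. Only the orders 0 and 1 are needed. -/
theorem coeff_eq_iteratedDeriv {χ : SL(2, ℤ) → ℤˣ → ℂ} {w : ℤ} (hx : xInf N r = 0)
    (hf : etaQuotient N r ∈ modForms N w χ) (n : ℕ) :
    coeff N r n = (n.factorial : ℂ)⁻¹ * iteratedDeriv n (discProd N r) 0 := by
  refine congrFun (eq_of_hasSum_qExp (B := fun n : ℕ =>
    (n.factorial : ℂ)⁻¹ * iteratedDeriv n (discProd N r) 0) hf.1 (periodic_etaQuotient hx)
    (fun τ => hasSum_coeff hx hf τ.im_pos) (fun τ => ?_)) n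
  have h1 := Complex.hasSum_taylorSeries_on_ball (differentiableOn_discProd (N := N) (r := r))
    (z := qExp τ) (by simpa using norm_qExp_lt_one τ.im_pos)
  rw [← etaProd_eq_discProd hx] at h1
  refine h1.congr_fun fun m => ?_
  simp only [sub_zero, smul_eq_mul]
  ring

theorem coeff_zero {χ : SL(2, ℤ) → ℤˣ → ℂ} {w : ℤ} (hx : xInf N r = 0)
    (hf : etaQuotient N r ∈ modForms N w χ) : coeff N r 0 = 1 := by
  rw [coeff_eq_iteratedDeriv hx hf]
  simp [discProd_zero]

theorem coeff_one {χ : SL(2, ℤ) → ℤˣ → ℂ} {w : ℤ} (hN : N ≠ 0) (hx : xInf N r = 0)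
    (hf : etaQuotient N r ∈ modForms N w χ) : coeff N r 1 = -r 1 := by
  rw [coeff_eq_iteratedDeriv hx hf]
  simp [deriv_discProd_zero hN]

end EtaQuotient

end

/-! ### Reduction to the line spanned by the eta-quotient -/

noncomputable section

namespace EtaQuotient

variable {N : ℕ} {r : ℕ → ℤ}

theorem norm_cpow_half (x : ℂ) : ‖x ^ (1 / 2 : ℂ)‖ = Real.sqrt ‖x‖ := by
  have h1 : ‖x ^ (1 / 2 : ℂ)‖ ^ 2 = ‖x‖ := by
    rw [← norm_pow, one_div]
    congr 1
    exact Complex.cpow_ofNat_inv_pow x 2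
  rw [← h1, Real.sqrt_sq (norm_nonneg _)]

/-- The element of `SL(2, ℤ)` with the given entries. -/
def mkSL (a b c d : ℤ) (h : a * d - b * c = 1) : SL(2, ℤ) :=
  ⟨!![a, b; c, d], by rw [Matrix.det_fin_two_of, h]⟩

theorem norm_slash_one (w : ℤ) (γ : SL(2, ℤ)) (ε : ℤˣ) (f : UpperHalfPlane → ℂ)
    (τ : UpperHalfPlane) : ‖slash w γ ε f τ‖ =
      Real.sqrt ‖(γ 1 0 : ℂ) * τ + (γ 1 1 : ℂ)‖ ^ (-w) * ‖f (γ • τ)‖ := by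
  rw [slash, norm_mul, norm_zpow, norm_mul, norm_cpow_half]
  congr 2
  rcases Int.units_eq_one_or ε with rfl | rfl <;> simp

theorem sqrt_den_pos (γ : SL(2, ℤ)) (τ : UpperHalfPlane) :
    0 < Real.sqrt ‖(γ 1 0 : ℂ) * τ + (γ 1 1 : ℂ)‖ := by
  apply Real.sqrt_pos.2
  rw [norm_pos_iff]
  have h := Matrix.det_fin_two γ.1
  rw [γ.2] at h
  exact int_den_ne_zero (a := γ 0 0) (b := γ 0 1) (by rw [← h]; simp) τ.im_pos

theorem isForm_etaProd (hN : N ≠ 0) (hx : xInf N r = 0) {χ : SL(2, ℤ) → ℤˣ → ℂ}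
    (hf : etaQuotient N r ∈ modForms N (twoK N r) χ) :
    IsForm N (twoK N r) (mult N r (xZero N r)) (etaProd N r) (coeff N r) where
  diff := differentiableOn_etaProd
  transf _ _ _ _ hc hd hdet _ hz := mult_transf hN hx hc hd hdet hz
  hasSum _ hz := hasSum_coeff hx hf hz
  bdd := by
    intro a b c d h
    obtain ⟨M, A, hM⟩ := UpperHalfPlane.isBoundedAtImInfty_iff.1 (hf.2.2 (mkSL a b c d h) 1)
    refine ⟨M, A, fun z hz hA => ?_⟩
    have h1 := hM ⟨z, hz⟩ hA
    have h2 := sqrt_den_pos (mkSL a b c d h) ⟨z, hz⟩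
    rw [norm_slash_one, zpow_neg, inv_mul_le_iff₀ (zpow_pos h2 _), mul_comm] at h1
    have h3 : etaQuotient N r (mkSL a b c d h • ⟨z, hz⟩) =
        etaProd N r ((a * z + b) / (c * z + d)) := by
      change etaProd N r (((mkSL a b c d h • ⟨z, hz⟩ : UpperHalfPlane)) : ℂ) = _
      rw [coe_smul_eq]
      rfl
    rw [h3] at h1
    exact h1

/-- A form with the multiplier of the eta-quotient `f` has the same behaviour as `f` under all of
`Γ₀(N)`. -/
theorem IsForm.cross_ratio (hN : N ≠ 0) {w : ℤ} {μ : ℤ → ℤ → ℂ} {F G : ℂ → ℂ} {A B : ℕ → ℂ}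
    (hF : IsForm N w μ F A) (hG : IsForm N w μ G B) {a b c d : ℤ}
    (hdet : a * d - b * (N * c) = 1) {z : ℂ} (hz : 0 < z.im) :
    G ((a * z + b) / (N * c * z + d)) * F z = F ((a * z + b) / (N * c * z + d)) * G z := by
  have pos : ∀ {a b c d : ℤ}, 0 < c → a * d - b * (N * c) = 1 →
      G ((a * z + b) / (N * c * z + d)) * F z = F ((a * z + b) / (N * c * z + d)) * G z := by
    intro a b c d hc hdet
    -- Replacing z by z - j changes d to d + j N c, so for c > 0 the lower right entry can be made
    -- positive; F and G are invariant under translation.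
    obtain ⟨j, hj⟩ : ∃ j : ℤ, 0 < d + j * (N * c) := by
      refine ⟨|d| + 1, ?_⟩
      have h1 : (1 : ℤ) ≤ N * c := by
        have : (0 : ℤ) < N * c := by positivity
        omega
      nlinarith [neg_abs_le d, abs_nonneg d]
    have hz' : 0 < (z + ((-j : ℤ) : ℂ)).im := by simpa using hz
    have hdet' : a * (d + j * (N * c)) - (b + j * a) * (N * c) = 1 := by
      linear_combination hdet
    have h1 := hF.transf a (b + j * a) c _ hc hj hdet' _ hz'
    have h2 := hG.transf a (b + j * a) c _ hc hj hdet' _ hz'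
    have e1 : (N * c * (z + ((-j : ℤ) : ℂ)) + (d + j * (N * c) : ℤ) : ℂ) = N * c * z + d := by
      push_cast; ring
    have e2 : (a * (z + ((-j : ℤ) : ℂ)) + (b + j * a : ℤ) : ℂ) = a * z + b := by
      push_cast; ring
    rw [e1, e2, hF.add_int hz] at h1
    rw [e1, e2, hG.add_int hz] at h2
    rw [h1, h2]
    ring
  rcases lt_trichotomy c 0 with hc | rfl | hc
  · have := pos (a := -a) (b := -b) (c := -c) (d := -d) (by omega) (by linear_combination hdet)
    have e : (((-a : ℤ) * z + (-b : ℤ)) / (N * (-c : ℤ) * z + (-d : ℤ)) : ℂ) =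
        (a * z + b) / (N * c * z + d) := by
      rw [← neg_div_neg_eq]
      push_cast
      ring_nf
    rwa [e] at this
  · have had : a * d = 1 := by linear_combination hdet
    rcases Int.mul_eq_one_iff_eq_one_or_neg_one.1 had with ⟨rfl, rfl⟩ | ⟨rfl, rfl⟩
    · have e : (((1 : ℤ) * z + b) / (N * (0 : ℤ) * z + (1 : ℤ)) : ℂ) = z + b := by simp
      rw [e, hF.add_int hz, hG.add_int hz, mul_comm]
    · have e : (((-1 : ℤ) * z + b) / (N * (0 : ℤ) * z + (-1 : ℤ)) : ℂ) = z + (-b : ℤ) := by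
        push_cast; simp [div_neg, add_comm]
      rw [e, hF.add_int hz, hG.add_int hz, mul_comm]
  · exact pos hc hdet

/-- A form with the multiplier of the eta-quotient on `c, d > 0` is a modular form for the
character of the eta-quotient. -/
theorem IsForm.mem_modForms (hN : N ≠ 0) (hx : xInf N r = 0) {χ : SL(2, ℤ) → ℤˣ → ℂ}
    (hf : etaQuotient N r ∈ modForms N (twoK N r) χ) {G : ℂ → ℂ} {B : ℕ → ℂ}
    (hG : IsForm N (twoK N r) (mult N r (xZero N r)) G B) :
    (fun τ : UpperHalfPlane => G τ) ∈ modForms N (twoK N r) χ := by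
  refine ⟨?_, fun γ hγ ε => ?_, fun γ ε => ?_⟩
  · rw [UpperHalfPlane.mdifferentiable_iff]
    refine hG.diff.congr fun z hz => ?_
    rw [Function.comp_apply, UpperHalfPlane.ofComplex_apply_of_im_pos hz]
  · funext τ
    have h1 := congrFun (hf.2.1 γ hγ ε) τ
    have hdvd : (N : ℤ) ∣ γ 1 0 := by
      rw [CongruenceSubgroup.Gamma0_mem] at hγ
      exact (ZMod.intCast_zmod_eq_zero_iff_dvd _ N).1 hγ
    obtain ⟨c, hc⟩ := hdvd
    have hdet := Matrix.det_fin_two γ.1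
    rw [γ.2] at hdet
    have h2 := (isForm_etaProd hN hx hf).cross_ratio hN hG (a := γ 0 0) (b := γ 0 1) (c := c)
      (d := γ 1 1) (by rw [← hc]; exact hdet.symm) τ.im_pos
    have e : (N : ℂ) * c = (γ 1 0 : ℂ) := by rw [hc]; push_cast; ring
    rw [e, ← coe_smul_eq] at h2
    have hne : etaProd N r τ ≠ 0 := etaProd_ne_zero τ.im_pos
    change slash _ γ ε _ τ = χ γ ε * G τ
    change _ = χ γ ε * etaProd N r τ at h1
    rw [slash] at h1 ⊢
    change _ * etaProd N r ((γ • τ : UpperHalfPlane) : ℂ) = _ at h1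
    -- f has no zeros, so multiplying by f(τ) and using the cross ratio transfers the character from
    -- f to G without computing χ.
    apply mul_right_cancel₀ hne
    rw [mul_assoc, h2, ← mul_assoc, h1]
    ring
  · rw [UpperHalfPlane.isBoundedAtImInfty_iff]
    have hdet := Matrix.det_fin_two γ.1
    rw [γ.2] at hdet
    obtain ⟨M, A, hM⟩ := hG.bdd (γ 0 0) (γ 0 1) (γ 1 0) (γ 1 1) hdet.symm
    refine ⟨M, A, fun τ hA => ?_⟩
    have h1 := hM τ τ.im_pos hA
    rw [norm_slash_one, zpow_neg, inv_mul_le_iff₀ (zpow_pos (sqrt_den_pos γ τ) _), mul_comm]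
    rw [← coe_smul_eq] at h1
    exact h1

/-- f tends to its constant term 1 at i∞. -/
theorem etaQuotient_notMem_cuspForms {χ : SL(2, ℤ) → ℤˣ → ℂ} {w : ℤ} (hx : xInf N r = 0) :
    etaQuotient N r ∉ cuspForms N w χ := by
  rintro ⟨hf, hzero⟩
  have h0 := hzero 1 1
  have h1 : slash w 1 1 (etaQuotient N r) = etaQuotient N r := by
    funext τ
    simp [slash]
  rw [h1] at h0
  have h2 : Filter.Tendsto (fun τ : UpperHalfPlane => discProd N r (qExp τ))
      UpperHalfPlane.atImInfty (nhds (discProd N r 0)) := by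
    have h3 : ContinuousAt (discProd N r) 0 :=
      ((differentiableOn_discProd (N := N) (r := r)).differentiableAt
        (Metric.isOpen_ball.mem_nhds (by simp))).continuousAt
    have h4 := UpperHalfPlane.qParam_tendsto_atImInfty one_pos
    simp only [qParam_one] at h4
    exact h3.tendsto.comp h4
  have h5 : (fun τ : UpperHalfPlane => discProd N r (qExp τ)) = etaQuotient N r := by
    funext τ
    exact (etaProd_eq_discProd hx τ).symm
  rw [h5, discProd_zero] at h2
  exact one_ne_zero (tendsto_nhds_unique h2 h0)

/-- In a one-dimensional space, the coefficients of a form `G` are `B 0` times those of the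
eta-quotient. -/
theorem IsForm.coeff_eq (hf : IsWeaklyAdmissible N r) (hN : N ≠ 0) (hx : xInf N r = 0)
    {G : ℂ → ℂ} {B : ℕ → ℂ} (hG : IsForm N (twoK N r) (mult N r (xZero N r)) G B) (n : ℕ) :
    B n = B 0 * coeff N r n := by
  have hrank : Module.rank ℂ (modForms N (twoK N r) (etaChar N r)) = 1 := by
    rcases hf.dim_eq with h | ⟨_, _, h⟩
    · exact h
    · exact absurd h (etaQuotient_notMem_cuspForms hx)
  have hfin : Module.finrank ℂ (modForms N (twoK N r) (etaChar N r)) = 1 :=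
    Module.rank_eq_one_iff_finrank_eq_one.1 hrank
  have hmem := hf.mem_modForms
  have hne : (⟨_, hmem⟩ : modForms N (twoK N r) (etaChar N r)) ≠ 0 := by
    intro h
    have h1 := congrFun (congrArg Subtype.val h) UpperHalfPlane.I
    exact etaProd_ne_zero (N := N) (r := r) UpperHalfPlane.I.im_pos h1
  obtain ⟨C, hC⟩ := (finrank_eq_one_iff_of_nonzero' _ hne).1 hfin
    ⟨_, hG.mem_modForms hN hx hmem⟩
  have hC' : ∀ τ : UpperHalfPlane, C * etaProd N r τ = G τ := fun τ =>
    congrFun (congrArg Subtype.val hC) τ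
  have hB : B = fun n => C * coeff N r n := by
    refine eq_of_hasSum_qExp (f := C • etaQuotient N r) (hmem.1.const_smul C) ?_ ?_ ?_
    · intro z
      have := periodic_etaQuotient (r := r) hx z
      simp only [Function.comp_apply, Pi.smul_apply] at this ⊢
      rw [this]
    · intro τ
      have := hG.hasSum τ τ.im_pos
      rw [← hC'] at this
      exact this
    · intro τ
      have := (hasSum_coeff hx hmem τ.im_pos).mul_left C
      simp only [← mul_assoc] at this
      exact this
  rw [hB]
  simp only [coeff_zero hx hmem, mul_one]

end EtaQuotient

end

noncomputable section

namespace EtaQuotient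

variable {N : ℕ} {r : ℕ → ℤ}

/-! ### Hecke operators on forms with the multiplier of an eta-quotient -/

theorem mult_congr {s t : ℤ} (h : (24 : ℤ) ∣ s - t) : mult N r s = mult N r t := by
  funext c d
  rw [mult, mult]
  congr 1
  apply e24_congr
  obtain ⟨k, hk⟩ := h
  exact ⟨-(d * c * k), by linear_combination -d * c * hk⟩

/-- For odd w, l is a square prime to e = d - N c B, so (l c / e) = (c / e). Moreover e ≡ d modulo 8
c, and (c / ·) has period 4 c on odd arguments. -/
theorem thetaPart_shift {w c d B : ℤ} (hw : Odd w → (8 : ℤ) ∣ N * B) {l : ℕ}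
    (hl : Odd w → IsSquare l) (hc : 0 < c) (hd : 0 < d) (hd' : 0 < d - N * c * B)
    (hodd : Odd w → Odd d) (hcop : IsCoprime (d - N * c * B) (l : ℤ)) :
    thetaPart w (l * c) (d - N * c * B) = thetaPart w c d := by
  rw [thetaPart, thetaPart]
  split_ifs with h
  · rfl
  · rw [Int.not_even_iff_odd] at h
    obtain ⟨m, rfl⟩ := hl h
    obtain ⟨t, ht⟩ := hw h
    have hdo := hodd h
    generalize he : d - N * c * B = e at *
    lift c to ℕ using hc.le
    lift d to ℕ using hd.le
    lift e to ℕ using hd'.le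
    simp only [Int.natAbs_natCast]
    have hdo' : Odd d := by exact_mod_cast hdo
    have hed : (d : ℤ) - e = 8 * (c * t) := by linear_combination c * ht + he
    have heo' : Odd e := by
      obtain ⟨u, hu⟩ := hdo'
      exact Nat.odd_iff.2 (by omega)
    have hm : (m : ℤ).gcd e = 1 := by
      rw [← Int.isCoprime_iff_gcd_eq_one]
      push_cast at hcop
      exact hcop.of_mul_right_left.symm
    have hJ : jacobiSym ((m * m : ℕ) * c : ℤ) e = jacobiSym c e := by
      rw [jacobiSym.mul_left, Nat.cast_mul, ← pow_two, jacobiSym.sq_one' hm, one_mul]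
    rw [hJ, jacobiSym.mod_right' c heo', jacobiSym.mod_right' c hdo']
    have : e ≡ d [MOD 4 * c] := by
      rw [← Int.natCast_modEq_iff]
      refine Int.modEq_iff_dvd.2 ⟨2 * t, ?_⟩
      push_cast
      linear_combination hed
    rw [this]

/-- U_l replaces (c, d) by (l c, d - N c B) in the multiplier. The theta part and the Nebentypus do
not change, so only s becomes l s. Oddness of l makes it prime to the auxiliary modulus, which B can
therefore absorb. -/
theorem IsForm.average_mult (hN : N ≠ 0) (hx : xInf N r = 0) {s : ℤ} {F : ℂ → ℂ} {A : ℕ → ℂ}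
    (hF : IsForm N (twoK N r) (mult N r s) F A) (hs : (24 : ℤ) ∣ N * auxModulus N * s)
    {l n : ℕ} (hl : Odd l) (hlN : l ∣ N ^ n) (hsq : Odd (twoK N r) → IsSquare l) :
    ∃ G, IsForm N (twoK N r) (mult N r (l * s)) G (fun m => A (l * m)) := by
  have : NeZero l := ⟨hl.pos.ne'⟩
  have hh : Nat.Coprime (auxModulus N) l := by
    rw [auxModulus]
    split_ifs
    · exact Nat.Coprime.pow_left 3 (Nat.coprime_two_left.2 hl)
    · exact Nat.coprime_one_left l
  refine ⟨_, hF.average (μ' := mult N r (l * s)) l (auxModulus N) hlN hh ?_⟩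
  intro c d B hc hd hcop hB hB0
  have hpos : 0 < d - N * c * B := by
    have : 0 ≤ (N : ℤ) * c * -B := mul_nonneg (by positivity) (by omega)
    linarith
  have hcop' : IsCoprime (d - N * c * B) (N : ℤ) := by
    obtain ⟨u, v, huv⟩ := hcop
    exact ⟨u, v * c + u * c * B, by linear_combination huv⟩
  have heven : Odd (twoK N r) → Even N := fun h => by
    by_contra h1
    exact Int.not_odd_iff_even.2 (even_twoK hx (Nat.not_even_iff_odd.1 h1)) h
  rw [mult, mult]
  congr 1
  · congr 1
    · refine thetaPart_shift (fun h => ?_) hsq hc hd hpos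
        (fun h => odd_of_isCoprime (heven h) hcop.of_mul_right_left) ?_
      · rw [auxModulus, if_pos (heven h)] at hB
        exact hB.mul_left _
      · exact (hcop'.pow_right (n := n)).of_isCoprime_of_dvd_right (by exact_mod_cast hlN)
    · refine nebentypus_periodic hN _ _ hpos hd hcop' ?_
      obtain ⟨t, rfl⟩ := hB
      exact ⟨-(c * t), by push_cast; ring⟩
  · apply e24_congr
    obtain ⟨t, rfl⟩ := hB
    obtain ⟨u, hu⟩ := hs
    exact ⟨c * l * c * t * u, by linear_combination c * l * c * t * hu⟩

theorem mult_of_even (hw : Even (twoK N r)) (s : ℤ) :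
    mult N r s = fun c d => nebentypus N r d * e24 (-(d * c * s)) := by
  funext c d
  rw [mult, thetaPart, if_pos hw, one_mul]

theorem sum_divisors_prime_mul {p l : ℕ} (hp : p.Prime) (hpl : ¬ p ∣ l) (g : ℕ → ℂ) :
    ∑ a ∈ (p * l).divisors, g a = ∑ a ∈ l.divisors, (g a + g (p * a)) := by
  have hp0 := hp.pos
  have h1 : (p * l).divisors = l.divisors ∪ l.divisors.image (p * ·) := by
    rw [Nat.divisors_mul, hp.divisors]
    ext x
    simp [Finset.mem_mul]
  rw [h1, Finset.sum_union, Finset.sum_image, Finset.sum_add_distrib]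
  · intro a _ b _ h
    exact Nat.eq_of_mul_eq_mul_left hp0 h
  · rw [Finset.disjoint_left]
    intro a ha hb
    obtain ⟨b, _, rfl⟩ := Finset.mem_image.1 hb
    exact hpl ((dvd_mul_right p b).trans (Nat.dvd_of_mem_divisors ha))

/-- One T_p for each prime p ∣ l. On constant terms T_p is multiplication by 1 + ψ(p) p^(k-1), and
these factors multiply out to the divisor sum. At indices prime to p the second term of T_p
vanishes. -/
theorem exists_hecke_form (hN : N ≠ 0) (hx : xInf N r = 0) {k : ℤ} (hk : twoK N r = 2 * k)
    {F : ℂ → ℂ} {A : ℕ → ℂ} (hF : IsForm N (twoK N r) (mult N r (xZero N r)) F A) (l : ℕ)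
    (hsq : Squarefree l) (hcop : Nat.Coprime l N)
    (hl : ∀ p : ℕ, p ∣ l → (24 : ℤ) ∣ (p ^ 2 - 1) * xZero N r) :
    ∃ G B, IsForm N (twoK N r) (mult N r (l * xZero N r)) G B ∧
      B 0 = A 0 * ∑ a ∈ l.divisors, nebentypus N r a * (a : ℂ) ^ (k - 1) ∧
      ∀ n, Nat.Coprime n l → B n = A (l * n) := by
  have hw : Even (twoK N r) := hk ▸ even_two_mul k
  have hψ := nebentypus_isChar (r := r) hN hw
  induction l using induction_on_primes with
  | zero => exact absurd hsq not_squarefree_zero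
  | one => exact ⟨F, A, by simpa using hF, by simp [nebentypus_one], by simp⟩
  | prime_mul p l hp ih =>
    obtain ⟨G, B, hG, hB0, hB⟩ := ih hsq.of_mul_right (hcop.coprime_dvd_left (dvd_mul_left _ _))
      fun q hq => hl q (hq.mul_left p)
    have : Fact p.Prime := ⟨hp⟩
    have hpl : ¬ p ∣ l := fun ⟨t, ht⟩ =>
      hp.not_isUnit (hsq p ⟨t, by rw [ht]; ring⟩)
    have hpN : ¬ p ∣ N := (Nat.Prime.coprime_iff_not_dvd hp).1
      (hcop.coprime_dvd_left (dvd_mul_right _ _))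
    have hhp : Nat.Coprime (auxModulus N) p := by
      rw [auxModulus]
      split_ifs with hev
      · refine Nat.Coprime.pow_left 3 (Nat.coprime_two_left.2 (hp.odd_of_ne_two ?_))
        rintro rfl
        exact hpN hev.two_dvd
      · exact Nat.coprime_one_left p
    have hs : (24 : ℤ) ∣ N * auxModulus N * (l * xZero N r) := by
      rw [mul_left_comm]; exact (dvd_mul_xZero hx).mul_left _
    have hps : (24 : ℤ) ∣ (p ^ 2 - 1) * (l * xZero N r) := by
      rw [mul_left_comm]; exact (hl p (dvd_mul_right _ _)).mul_left _
    rw [hk] at hG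
    have hnew := hG.hecke_isForm hψ hhp hpN hs hps fun c d _ _ _ => by rw [mult_of_even hw]
    have e : mult N r ((p * l : ℕ) * xZero N r) =
        fun c d => nebentypus N r d * e24 (-(d * c * (p * (l * xZero N r)))) := by
      rw [mult_of_even hw]
      funext c d
      push_cast
      rw [mul_assoc (p : ℤ)]
    rw [← e, ← hk] at hnew
    refine ⟨_, _, hnew, ?_, fun n hn => ?_⟩
    · have h1 : ∀ a ∈ l.divisors, nebentypus N r a * (a : ℂ) ^ (k - 1) +
          nebentypus N r (p * a : ℕ) * ((p * a : ℕ) : ℂ) ^ (k - 1) =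
          (1 + nebentypus N r p * (p : ℂ) ^ (k - 1)) *
            (nebentypus N r a * (a : ℂ) ^ (k - 1)) := by
        intro a ha
        have hpN' : IsCoprime (p : ℤ) (N : ℤ) :=
          Nat.isCoprime_iff_coprime.2 ((Nat.Prime.coprime_iff_not_dvd hp).2 hpN)
        have haN : IsCoprime (a : ℤ) (N : ℤ) := Nat.isCoprime_iff_coprime.2
          (hcop.coprime_dvd_left ((Nat.dvd_of_mem_divisors ha).mul_left p))
        push_cast
        rw [hψ.mul p a (by exact_mod_cast hp.pos) (by exact_mod_cast Nat.pos_of_mem_divisors ha)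
          hpN' haN, mul_zpow]
        ring
      simp only [mul_zero, dvd_zero, if_true, Nat.zero_div]
      rw [sum_divisors_prime_mul hp hpl (fun a : ℕ => nebentypus N r a * (a : ℂ) ^ (k - 1)),
        Finset.sum_congr rfl h1, ← Finset.mul_sum, hB0]
      ring
    · have hpn : ¬ p ∣ n := (Nat.Prime.coprime_iff_not_dvd hp).1
        (Nat.Coprime.coprime_dvd_right (dvd_mul_right _ _) hn).symm
      have hnl : Nat.Coprime n l := hn.coprime_dvd_right (dvd_mul_left _ _)
      have hpl' : Nat.Coprime p l := (Nat.Prime.coprime_iff_not_dvd hp).2 hpl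
      rw [if_neg hpn, mul_zero, add_zero, hB _ (hpl'.mul_left hnl)]
      congr 1
      ring

end EtaQuotient

end

noncomputable section

namespace EtaQuotient

/-! ### The coefficients of weakly admissible eta-quotients -/

theorem exists_mul_dvd_pow_coprime (N : ℕ) {l : ℕ} (hl : l ≠ 0) :
    ∃ l₁ l₂ n, l = l₁ * l₂ ∧ l₁ ∣ N ^ n ∧ Nat.Coprime l₂ N := by
  induction l using induction_on_primes with
  | zero => exact absurd rfl hl
  | one => exact ⟨1, 1, 0, rfl, one_dvd _, Nat.coprime_one_left N⟩
  | prime_mul p l hp ih =>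
    obtain ⟨l₁, l₂, n, rfl, h1, h2⟩ := ih (right_ne_zero_of_mul hl)
    by_cases hpN : p ∣ N
    · exact ⟨p * l₁, l₂, n + 1, by ring, by rw [pow_succ']; exact mul_dvd_mul hpN h1, h2⟩
    · exact ⟨l₁, p * l₂, n, by ring, h1,
        ((Nat.Prime.coprime_iff_not_dvd hp).2 hpN).mul_left h2⟩

theorem filter_coprime_divisors {N l₁ l₂ n : ℕ} (h0 : l₁ * l₂ ≠ 0) (h1 : l₁ ∣ N ^ n)
    (h2 : Nat.Coprime l₂ N) :
    (l₁ * l₂).divisors.filter (fun a => Nat.Coprime a N) = l₂.divisors := by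
  ext a
  simp only [Finset.mem_filter, Nat.mem_divisors]
  constructor
  · rintro ⟨⟨h, _⟩, ha⟩
    exact ⟨((ha.pow_right n).coprime_dvd_right h1).dvd_of_dvd_mul_left h, right_ne_zero_of_mul h0⟩
  · rintro ⟨h, _⟩
    exact ⟨⟨h.mul_left _, h0⟩, h2.coprime_dvd_left h⟩

theorem filter_coprime_divisors_eq_one {N l : ℕ} (hl : l ≠ 0)
    (h : ∀ p : ℕ, p.Prime → p ∣ l → p ∣ N) :
    l.divisors.filter (fun a => Nat.Coprime a N) = {1} := by
  ext a
  simp only [Finset.mem_filter, Nat.mem_divisors, Finset.mem_singleton]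
  constructor
  · rintro ⟨⟨hal, _⟩, haN⟩
    by_contra ha
    obtain ⟨p, hp, hpa⟩ := Nat.exists_prime_and_dvd ha
    exact hp.one_lt.ne' (Nat.dvd_one.1 (haN ▸ Nat.dvd_gcd hpa (h p hp (hpa.trans hal))))
  · rintro rfl
    exact ⟨⟨one_dvd _, hl⟩, Nat.coprime_one_left N⟩

variable {N : ℕ} {r : ℕ → ℤ}

/-- With `xInf` = 0, m_f · gcd(24, `xZero`) = 24. -/
theorem dvd_sub_one_mul_xZero (hx : xInf N r = 0) {l : ℕ} (hl : l ≡ 1 [MOD mf N r]) :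
    (24 : ℤ) ∣ ((l : ℤ) - 1) * xZero N r := by
  have h1 : ((mf N r : ℕ) : ℤ) ∣ (l : ℤ) - 1 := by
    have := (Nat.modEq_iff_dvd.1 hl.symm)
    exact_mod_cast this
  have hg : Nat.gcd 24 (Int.gcd (xZero N r) (xInf N r)) = Nat.gcd 24 (xZero N r).natAbs := by
    rw [hx, Int.gcd_zero_right]
  have h2 : mf N r * Nat.gcd 24 (xZero N r).natAbs = 24 := by
    rw [mf, hg]
    exact Nat.div_mul_cancel (Nat.gcd_dvd_left _ _)
  have h3 : ((Nat.gcd 24 (xZero N r).natAbs : ℕ) : ℤ) ∣ xZero N r :=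
    Int.natCast_dvd.2 (Nat.gcd_dvd_right _ _)
  have h4 := mul_dvd_mul h1 h3
  rwa [← Nat.cast_mul, h2] at h4

/-- Modulo 8, if p is even then p q - 1 is a unit and y ≡ 0, while if p is odd then p² ≡ 1; likewise
modulo 3. This passes the condition on l to each prime p ∣ l, as T_p requires. -/
theorem dvd_sq_sub_one_mul {p q y : ℤ} (h : (24 : ℤ) ∣ (p * q - 1) * y) :
    (24 : ℤ) ∣ (p ^ 2 - 1) * y := by
  have d8 : ∀ p q y : ZMod 8, (p * q - 1) * y = 0 → (p ^ 2 - 1) * y = 0 := by decide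
  have d3 : ∀ p q y : ZMod 3, (p * q - 1) * y = 0 → (p ^ 2 - 1) * y = 0 := by decide
  have h8 : (8 : ℤ) ∣ (p ^ 2 - 1) * y := by
    have := d8 p q y (by
      have := (ZMod.intCast_zmod_eq_zero_iff_dvd _ 8).2 (dvd_trans (by norm_num) h)
      push_cast at this
      exact this)
    exact (ZMod.intCast_zmod_eq_zero_iff_dvd _ 8).1 (by push_cast; exact this)
  have h3 : (3 : ℤ) ∣ (p ^ 2 - 1) * y := by
    have := d3 p q y (by
      have := (ZMod.intCast_zmod_eq_zero_iff_dvd _ 3).2 (dvd_trans (by norm_num) h)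
      push_cast at this
      exact this)
    exact (ZMod.intCast_zmod_eq_zero_iff_dvd _ 3).1 (by push_cast; exact this)
  omega

theorem IsWeaklyAdmissible.level_ne_zero (hf : IsWeaklyAdmissible N r) : N ≠ 0 := by
  rintro rfl
  -- 0 has an empty set of divisors here, so the least common multiple would be 1.
  simpa using hf.level_eq

/-- In half-integral weight, every prime divisor of an admissible index divides the level. -/
theorem prime_dvd_level_of_odd_twoK {l : ℕ} (hl : l ∈ Lf N r)
    (hsf : ∀ p : ℕ, p.Prime → ¬ p ∣ N → ¬ p ^ 2 ∣ l) (hw : Odd (twoK N r)) (p : ℕ)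
    (hp : p.Prime) (hpl : p ∣ l) : p ∣ N := by
  by_contra h
  obtain ⟨s, rfl⟩ := hl.2.2 hw
  refine hsf p hp h ?_
  have : p ∣ s := (hp.dvd_mul.1 hpl).elim id id
  rw [← sq]
  exact pow_dvd_pow_of_dvd this 2

/-- The Hecke operators for l₂ followed by U_{l₁} send f to a form whose multiplier has l x₀ ≡ x₀ in
place of x₀, hence to a multiple of f; its coefficients at 0 and 1 give the formula. -/
theorem coeff_eq_sum_nebentypus (hf : IsWeaklyAdmissible N r) (hx : xInf N r = 0) {l : ℕ}
    (hl : l ∈ Lf N r) (hsf : ∀ p : ℕ, p.Prime → ¬ p ∣ N → ¬ p ^ 2 ∣ l) (hodd : Odd l ∨ Odd N) :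
    coeff N r l = -(r 1 : ℂ) * ∑ a ∈ l.divisors.filter (fun a => Nat.Coprime a N),
      nebentypus N r a * (a : ℂ) ^ ((twoK N r : ℂ) / 2 - 1) := by
  have hN := hf.level_ne_zero
  have hmem := hf.mem_modForms
  have hF := isForm_etaProd hN hx hmem
  have hl0 : l ≠ 0 := (Nat.one_le_iff_ne_zero).1 hl.1
  have hly := dvd_sub_one_mul_xZero hx hl.2.1
  obtain ⟨l₁, l₂, n, rfl, h1, h2⟩ := exists_mul_dvd_pow_coprime N hl0
  -- If l is even then N is odd, and all factors 2 lie in l₂.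
  have hl₁ : Odd l₁ := by
    rcases hodd with h | h
    · exact (Nat.odd_mul.1 h).1
    · exact h.pow.of_dvd_nat h1
  rcases Int.even_or_odd (twoK N r) with hw | hw
  · obtain ⟨k, hk⟩ := hw
    have hk : twoK N r = 2 * k := by omega
    have hsq : Squarefree l₂ := by
      rw [Nat.squarefree_iff_prime_squarefree]
      intro p hp hpp
      refine hsf p hp (fun h => ?_) ?_
      · exact (Nat.Prime.coprime_iff_not_dvd hp).1
          (h2.coprime_dvd_left ((dvd_mul_right p p).trans hpp)) h
      · rw [sq]
        exact hpp.mul_left l₁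
    obtain ⟨G, B, hG, hB0, hB⟩ := exists_hecke_form hN hx hk hF l₂ hsq h2 fun p ⟨q, hq⟩ =>
      dvd_sq_sub_one_mul (q := q * l₁) (by rw [hq] at hly; push_cast at hly; convert hly using 2; ring)
    have hs : (24 : ℤ) ∣ N * auxModulus N * (l₂ * xZero N r) := by
      rw [mul_left_comm]; exact (dvd_mul_xZero hx).mul_left _
    obtain ⟨H, hH⟩ := hG.average_mult hN hx hs hl₁ h1 fun h =>
      absurd (hk ▸ even_two_mul k) (Int.not_even_iff_odd.2 h)
    rw [mult_congr (t := xZero N r) (by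
      push_cast at hly; convert hly using 1; ring)] at hH
    -- The coefficient of H at 1 is B(l₁) = c_f(l₁ l₂), and its coefficient at 0 is the divisor sum
    -- B(0).
    have h3 := hH.coeff_eq hf hN hx 1
    have hcop : Nat.Coprime l₁ l₂ := ((h2.pow_right n).coprime_dvd_right h1).symm
    simp only [mul_one, mul_zero] at h3
    rw [hB _ hcop, hB0, coeff_zero hx hmem, one_mul, coeff_one hN hx hmem, mul_comm l₂ l₁] at h3
    rw [h3, filter_coprime_divisors hl0 h1 h2, mul_comm]
    congr 1
    refine Finset.sum_congr rfl fun a _ => ?_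
    rw [← Complex.cpow_intCast, hk]
    congr 2
    push_cast
    ring
  · have hdvd := prime_dvd_level_of_odd_twoK hl hsf hw
    have hl₂ : l₂ = 1 := by
      by_contra h
      obtain ⟨p, hp, hpl⟩ := Nat.exists_prime_and_dvd h
      exact (Nat.Prime.coprime_iff_not_dvd hp).1 (h2.coprime_dvd_left hpl)
        (hdvd p hp (hpl.mul_left l₁))
    rw [filter_coprime_divisors_eq_one hl0 hdvd]
    subst hl₂
    rw [mul_one] at hly hl ⊢
    obtain ⟨H, hH⟩ := hF.average_mult hN hx (dvd_mul_xZero hx) hl₁ h1 hl.2.2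
    rw [mult_congr (t := xZero N r) (by convert hly using 1; ring)] at hH
    have h3 := hH.coeff_eq hf hN hx 1
    simp only [mul_one, mul_zero] at h3
    rw [h3, coeff_zero hx hmem, one_mul, coeff_one hN hx hmem]
    simp [nebentypus_one]

/-! ### Comparison with the Kronecker-Jacobi symbol -/

theorem kronecker_natCast {m n : ℕ} (hn : n ≠ 0) : kronecker m n =
    ZMod.χ₈ (m : ZMod 8) ^ n.factorization 2 * jacobiSym m (n / 2 ^ n.factorization 2) := by
  rw [kronecker, if_neg (by exact_mod_cast hn), if_neg (by omega), one_mul, Int.natAbs_natCast]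
  push_cast
  rfl

theorem nebentypus_eq_kronecker_of_odd_level (hN : Odd N) (a : ℕ) :
    nebentypus N r a = kronecker a (bigPi N r) := by
  have h0 : (bigPi N r).factorization 2 = 0 :=
    Nat.factorization_eq_zero_of_not_dvd (odd_bigPi hN).not_two_dvd_nat
  rw [kronecker_natCast (bigPi_ne_zero (hN.pos.ne')), h0, nebentypus,
    if_neg (Nat.not_even_iff_odd.2 hN)]
  simp

/-- Write Π = 2^v P with P odd. Then (2 / a) = χ₈(a), and reciprocity between P and a = 2 t + 1
costs the sign (-1)^(t (P - 1) / 2), which δ encodes. -/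
theorem jacobiSym_bigPi_eq_kronecker (hN : N ≠ 0) (t : ℕ) :
    (jacobiSym (bigPi N r) (2 * t + 1) : ℂ) =
      kronecker ((2 * t + 1 : ℕ) : ℤ) (bigPi N r) * e24 (12 * (delta N r * t)) := by
  have h0 := bigPi_ne_zero (r := r) hN
  have ht : Odd (2 * t + 1) := odd_two_mul_add_one t
  rw [kronecker_natCast h0, delta]
  set v := (bigPi N r).factorization 2
  set P := bigPi N r / 2 ^ v with hP
  have hmul : bigPi N r = 2 ^ v * P := (Nat.ordProj_mul_ordCompl_eq_self _ 2).symm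
  have hPodd : Odd P := by
    rw [← Nat.not_even_iff_odd, even_iff_two_dvd]
    exact Nat.not_dvd_ordCompl Nat.prime_two h0
  have hsign : ((-1 : ℂ)) ^ (P / 2 * ((2 * t + 1) / 2)) =
      e24 (12 * (((if P % 4 = 3 then 1 else 0 : ℕ) : ℤ) * t)) := by
    rw [e24_twelve_mul, show (2 * t + 1) / 2 = t by omega, pow_mul]
    have := Nat.odd_iff.1 hPodd
    split_ifs with h
    · have h2 : Odd (P / 2) := Nat.odd_iff.2 (by omega)
      rw [h2.neg_one_pow]
      simp
    · have h2 : Even (P / 2) := Nat.even_iff.2 (by omega)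
      rw [h2.neg_one_pow]
      simp
  rw [← hsign, hmul]
  push_cast
  rw [jacobiSym.mul_left, jacobiSym.pow_left, jacobiSym.at_two ht,
    jacobiSym.quadratic_reciprocity hPodd ht]
  push_cast
  ring

/-- With a = 2 t + 1 and l / a = 2 s + 1 one has l - l / a = 2 t (2 s + 1). The factor 2 s + 1 may
be replaced by 1, since the exponents then differ by 12 t s (2 k + 2 δ), a multiple of 24 for
integral k; in half-integral weight a = 1 and t = 0. -/
theorem nebentypus_eq_kronecker_mul_exp (hN : N ≠ 0) (hx : xInf N r = 0) {a l : ℕ} (hal : a ∣ l)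
    (hl : Odd l) (hw : Even (twoK N r) ∨ a = 1) :
    nebentypus N r a = kronecker a (bigPi N r) *
      Complex.exp (2 * Real.pi * Complex.I *
        (((twoK N r : ℂ) / 2 + (delta N r : ℂ)) * ((l : ℂ) - ((l / a : ℕ) : ℂ)) / 4)) := by
  have ha := hl.of_dvd_nat hal
  obtain ⟨D, rfl⟩ := hal
  obtain ⟨s, rfl⟩ := (Nat.odd_mul.1 hl).2
  rw [nebentypus_of_odd hx ha, Nat.mul_div_cancel_left _ ha.pos]
  obtain ⟨t, rfl⟩ := ha
  rw [jacobiSym_bigPi_eq_kronecker hN, mul_assoc, ← e24_add]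
  congr 1
  have he : Complex.exp (2 * Real.pi * Complex.I * (((twoK N r : ℂ) / 2 + (delta N r : ℂ)) *
      ((((2 * t + 1) * (2 * s + 1) : ℕ) : ℂ) - ((2 * s + 1 : ℕ) : ℂ)) / 4)) =
      e24 (6 * (twoK N r + 2 * delta N r) * (t * (2 * s + 1))) := by
    rw [e24]
    congr 1
    push_cast
    ring
  rw [he]
  apply e24_congr
  rcases hw with ⟨k, hk⟩ | h
  · exact ⟨-((k + delta N r) * t * s), by rw [hk]; push_cast; ring⟩
  · obtain rfl : t = 0 := by omega
    simp

end EtaQuotient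

end

/-! ### The main theorem -/

open EtaQuotient in
theorem theorem9p9 (N : ℕ) (r : ℕ → ℤ) (hf : IsWeaklyAdmissible N r) (hx : xInf N r = 0) :
    (∀ τ : UpperHalfPlane,
      HasSum (fun n : ℕ => coeff N r n * Complex.exp (2 * Real.pi * Complex.I * (τ : ℂ)) ^ n)
        (etaQuotient N r τ)) ∧
    ∀ l ∈ Lf N r, (∀ p : ℕ, p.Prime → ¬ p ∣ N → ¬ p ^ 2 ∣ l) → (Odd l ∨ Odd N) →
      (Even l → Odd N →
        coeff N r l = -(r 1 : ℂ) * ∑ a ∈ l.divisors.filter (fun a => Nat.Coprime a N),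
          (kronecker (a : ℤ) (bigPi N r : ℤ) : ℂ) * (a : ℂ) ^ ((twoK N r : ℂ) / 2 - 1)) ∧
      (Odd l →
        coeff N r l = -(r 1 : ℂ) * ∑ a ∈ l.divisors.filter (fun a => Nat.Coprime a N),
          (kronecker (a : ℤ) (bigPi N r : ℤ) : ℂ) * (a : ℂ) ^ ((twoK N r : ℂ) / 2 - 1) *
            Complex.exp (2 * Real.pi * Complex.I *
              (((twoK N r : ℂ) / 2 + (delta N r : ℂ)) * ((l : ℂ) - ((l / a : ℕ) : ℂ)) / 4))) ∧
      (UniqueFactorizationMonoid.radical l ∣ UniqueFactorizationMonoid.radical N →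
        coeff N r l = -(r 1 : ℂ)) := by
  refine ⟨fun τ => hasSum_coeff hx hf.mem_modForms τ.im_pos, fun l hl hsf hodd => ?_⟩
  have hl0 : l ≠ 0 := Nat.one_le_iff_ne_zero.1 hl.1
  rw [coeff_eq_sum_nebentypus hf hx hl hsf hodd]
  refine ⟨fun _ hN => ?_, fun hlo => ?_, fun hrad => ?_⟩
  · simp only [nebentypus_eq_kronecker_of_odd_level hN]
  · congr 1
    refine Finset.sum_congr rfl fun a ha => ?_
    have hw : Even (twoK N r) ∨ a = 1 := by
      rcases Int.even_or_odd (twoK N r) with h | h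
      · exact Or.inl h
      · rw [filter_coprime_divisors_eq_one hl0 (prime_dvd_level_of_odd_twoK hl hsf h)] at ha
        exact Or.inr (Finset.mem_singleton.1 ha)
    rw [nebentypus_eq_kronecker_mul_exp hf.level_ne_zero hx
      (Nat.dvd_of_mem_divisors (Finset.mem_filter.1 ha).1) hlo hw]
    ring
  · rw [filter_coprime_divisors_eq_one hl0]
    · simp [nebentypus_one]
    · intro p hp hpl
      have h1 : p ∣ UniqueFactorizationMonoid.radical l :=
        (UniqueFactorizationMonoid.dvd_radical_iff_of_irreducible hp.prime.irreducible hl0).2 hpl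
      exact (h1.trans hrad).trans UniqueFactorizationMonoid.radical_dvd_self
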